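/- Let $K$ be a field, $R=K[x_0,\dots,x_n]$ with the standard grading and the order $x_0<\cdots<x_n$ of the variables. The Pommaret cone of a term $x^\alpha$ is the set of terms $x^\delta x^\alpha$ such that every variable dividing $x^\delta$ is at most the smallest variable dividing $x^\alpha$ (the cone of $1$ is the set of all terms). A monomial ideal $\tilde I\subseteq R$ is quasi-stable if it is generated by a finite set of terms such that the terms in $\tilde I$ are the disjoint union of the Pommaret cones of the terms in this set. Let $\tilde I\subseteq R$ be a quasi-stable ideal that is saturated with respect to $(x_0,\dots,x_n)$, and let $S=R/\tilde I$. A monomial ideal $U$ of $S$ (an ideal generated by images of terms) is a lex-ideal if for all terms $u,v\notin\tilde I$ of the same degree such that the image of $u$ lies in $U$ and $v>_{\mathrm{lex}}u$, also the image of $v$ lies in $U$. Assume that $S$ is Macaulay--Lex: for every homogeneous ideal of $S$ there is a lex-ideal of $S$ with the same Hilbert function. Let $X=\operatorname{Proj}(S)$ and $p(z)\in\mathbb Q[z]$. For a field extension $L$ of $K$, the Hilbert function of a closed subscheme $Z\subseteq X_L\subseteq\mathbb P^n_L$ is the Hilbert function of its homogeneous coordinate ring $L[x_0,\dots,x_n]/I_Z$,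 where $I_Z$ is the saturated homogeneous ideal generated by the forms vanishing on $Z$; the Hilbert polynomial of $Z$ is the polynomial that agrees with it in all large degrees. The Hilbert functor of $X$ and $p(z)$ sends a $K$-scheme $T$ to the set of closed subschemes of $X\times_K T$ that are flat and locally of finite presentation over $T$ and all of whose fibres have Hilbert polynomial $p(z)$; the Hilbert scheme $\mathrm{Hilb}^X_{p(z)}$ is the $K$-scheme that represents it. A point of $\mathrm{Hilb}^X_{p(z)}$ is said to be defined by a lex-ideal $U$ of $S$ if it is the $K$-rational point that corresponds to the closed subscheme $\operatorname{Proj}(S/U)$ of $X$. Then $\mathrm{Hilb}^X_{p(z)}$ is non-empty if and only if it contains a point $Y$ defined by a lex-ideal of $S$, and in this case this point is unique. Moreover, $Y$ has the minimal Hilbert function among the points of $\mathrm{Hilb}^X_{p(z)}$: for every point $y$ and every degree $d$, the Hilbert function of $Y$ at $d$ is at most that of the closed subscheme of $X_{\kappa(y)}$ that corresponds to $y$. The same holds for the Hilbert functor itself, without reference to its representability: it has an element over some non-empty $K$-scheme if and only if it has an element over $K$ of the form $\operatorname{Proj}(S/U)\subseteq X$ with $U$ a lex-ideal of $S$; this closed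 subscheme of $X$ is unique; and its Hilbert function is at most, in every degree, that of every fibre of every element of the Hilbert functor. -/

import Mathlib

open CategoryTheory CategoryTheory.Limits AlgebraicGeometry MvPolynomial
open scoped Graded DirectSum

universe u

noncomputable section

namespace LexPoint

/-! ### Quotients of graded algebras by homogeneous ideals -/

section Quotient

variable {K A : Type u} [Field K] [CommRing A] [Algebra K A]

/-- The grading induced on `A ⧸ J`: the degree `d` part is the image of the degree `d` part of
`A`. -/
def quotGrading (𝒜 : ℕ → Submodule K A) [GradedAlgebra 𝒜] (J : HomogeneousIdeal 𝒜) :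
    ℕ → Submodule K (A ⧸ J.toIdeal) :=
  fun d => (𝒜 d).map (Ideal.Quotient.mkₐ K J.toIdeal).toLinearMap

variable (𝒜 : ℕ → Submodule K A) [GradedAlgebra 𝒜] (J : HomogeneousIdeal 𝒜)

theorem mk_mem_quotGrading {d : ℕ} {a : A} (ha : a ∈ 𝒜 d) :
    Ideal.Quotient.mk J.toIdeal a ∈ quotGrading 𝒜 J d :=
  ⟨a, ha, rfl⟩

instance quotGradedMonoid : SetLike.GradedMonoid (quotGrading 𝒜 J) where
  one_mem := ⟨1, SetLike.GradedOne.one_mem, rfl⟩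
  mul_mem := by
    rintro i j _ _ ⟨a, ha, rfl⟩ ⟨b, hb, rfl⟩
    exact ⟨a * b, SetLike.GradedMul.mul_mem ha hb, rfl⟩

/-- The homogeneous components of the class of `a`, as a function of `a`. -/
def quotDecomposeAux : A →+ ⨁ d, quotGrading 𝒜 J d :=
  (DirectSum.map (fun d =>
    ({ toFun := fun a => ⟨Ideal.Quotient.mk J.toIdeal a.1, mk_mem_quotGrading 𝒜 J a.2⟩
       map_zero' := by ext; simp
       map_add' := by intro a b; ext; simp } : 𝒜 d →+ quotGrading 𝒜 J d))).comp
    (DirectSum.decomposeAddEquiv 𝒜).toAddMonoidHom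

theorem quotDecomposeAux_apply (a : A) (d : ℕ) :
    (quotDecomposeAux 𝒜 J a d : A ⧸ J.toIdeal) =
      Ideal.Quotient.mk J.toIdeal (DirectSum.decompose 𝒜 a d) := rfl

theorem quotDecomposeAux_of_mem {a : A} {d : ℕ} (ha : a ∈ 𝒜 d) :
    quotDecomposeAux 𝒜 J a =
      DirectSum.of (fun d => quotGrading 𝒜 J d) d ⟨_, mk_mem_quotGrading 𝒜 J ha⟩ := by
  refine DFinsupp.ext fun e => Subtype.ext ?_
  rw [quotDecomposeAux_apply]
  by_cases h : d = e
  · subst h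
    rw [DirectSum.decompose_of_mem_same 𝒜 ha, DirectSum.of_eq_same]
  · rw [DirectSum.decompose_of_mem_ne 𝒜 ha h, DirectSum.of_eq_of_ne _ _ _ (Ne.symm h)]
    simp

theorem quotDecomposeAux_of_mem_ideal {a : A} (ha : a ∈ J.toIdeal) :
    quotDecomposeAux 𝒜 J a = 0 := by
  refine DFinsupp.ext fun d => Subtype.ext ?_
  rw [quotDecomposeAux_apply]
  exact Ideal.Quotient.eq_zero_iff_mem.mpr (J.isHomogeneous.mem_iff 𝒜 |>.mp ha d)

/-- The decomposition of an element of `A ⧸ J` into its homogeneous components. -/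
def quotDecompose : A ⧸ J.toIdeal →+ ⨁ d, quotGrading 𝒜 J d :=
  QuotientAddGroup.lift J.toIdeal.toAddSubgroup (quotDecomposeAux 𝒜 J)
    (fun _ ha => quotDecomposeAux_of_mem_ideal 𝒜 J ha)

theorem quotDecompose_mk (a : A) :
    quotDecompose 𝒜 J (Ideal.Quotient.mk J.toIdeal a) = quotDecomposeAux 𝒜 J a := rfl

instance quotDecomposition : DirectSum.Decomposition (quotGrading 𝒜 J) :=
  DirectSum.Decomposition.ofAddHom (quotGrading 𝒜 J) (quotDecompose 𝒜 J)
    (by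
      refine AddMonoidHom.ext fun x => ?_
      obtain ⟨a, rfl⟩ := Ideal.Quotient.mk_surjective x
      rw [AddMonoidHom.comp_apply, quotDecompose_mk, AddMonoidHom.id_apply]
      induction a using DirectSum.Decomposition.inductionOn 𝒜 with
      | zero => simp
      | homogeneous m => simp [quotDecomposeAux_of_mem 𝒜 J m.2]
      | add m m' h h' => rw [map_add, map_add, h, h', map_add])
    (by
      refine DirectSum.addHom_ext fun d y => ?_
      obtain ⟨_, a, ha, rfl⟩ := y
      rw [AddMonoidHom.comp_apply, DirectSum.coeAddMonoidHom_of, AddMonoidHom.id_apply]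
      exact quotDecomposeAux_of_mem 𝒜 J ha)

instance quotGradedAlgebra : GradedAlgebra (quotGrading 𝒜 J) where

/-- The quotient map `A → A ⧸ J` as a homomorphism of graded rings. -/
def quotMk : 𝒜 →+*ᵍ quotGrading 𝒜 J where
  toRingHom := Ideal.Quotient.mk J.toIdeal
  map_mem := fun ha => mk_mem_quotGrading 𝒜 J ha

theorem irrelevant_le_map_quotMk :
    HomogeneousIdeal.irrelevant (quotGrading 𝒜 J) ≤
      (HomogeneousIdeal.irrelevant 𝒜).map (quotMk 𝒜 J) := by
  change (HomogeneousIdeal.irrelevant (quotGrading 𝒜 J)).toIdeal ≤ _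
  rw [HomogeneousIdeal.irrelevant_eq_span, Ideal.span_le]
  intro x hx
  simp only [Set.mem_iUnion] at hx
  obtain ⟨d, hd, a, ha, rfl⟩ := hx
  exact Ideal.mem_map_of_mem _ (HomogeneousIdeal.mem_irrelevant_of_mem 𝒜 hd ha)

/-- The closed subscheme `Proj (A ⧸ J) ⟶ Proj A` defined by the homogeneous ideal `J`. -/
def projQuotι : Proj (quotGrading 𝒜 J) ⟶ Proj 𝒜 :=
  Proj.map (quotMk 𝒜 J) (irrelevant_le_map_quotMk 𝒜 J)

/-- The structure morphism `Proj A ⟶ Spec K` of a graded `K`-algebra `A`. -/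
def projStr : Proj 𝒜 ⟶ Spec (.of K) :=
  Proj.toSpecZero 𝒜 ≫ Spec.map (CommRingCat.ofHom (algebraMap K (𝒜 0)))

/-- The Hilbert function `d ↦ dim_K J_d` of a homogeneous ideal `J`. -/
def idealHilbertFunction (d : ℕ) : ℕ :=
  Module.finrank K ↥(J.toIdeal.restrictScalars K ⊓ 𝒜 d)

/-- The Hilbert function `d ↦ dim_K (A ⧸ J)_d` of the quotient by a homogeneous ideal `J`. -/
def quotHilbertFunction (d : ℕ) : ℕ :=
  Module.finrank K ↥(quotGrading 𝒜 J d)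

end Quotient

/-! ### Monomial ideals of `R = K[x_0, …, x_n]` -/

section Monomial

variable {n : ℕ}

/-- A term `x^α` of `K[x_0, …, x_n]`, represented by its exponent vector. -/
abbrev Term (n : ℕ) := Fin (n + 1) →₀ ℕ

/-- The standard grading of `R = K[x_0, …, x_n]`. -/
abbrev stdGrading (n : ℕ) (K : Type u) [Field K] :
    ℕ → Submodule K (MvPolynomial (Fin (n + 1)) K) :=
  homogeneousSubmodule (Fin (n + 1)) K

instance stdGradedAlgebra (n : ℕ) (K : Type u) [Field K] : GradedAlgebra (stdGrading n K) :=
  gradedAlgebra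

/-- `x_i` is a multiplicative variable of `x^α`: it is at most the smallest variable dividing
`x^α` (every variable is multiplicative for the term `1`). -/
def IsMultiplicative (α : Term n) (i : Fin (n + 1)) : Prop :=
  ∀ j, α j ≠ 0 → i ≤ j

/-- The Pommaret cone of `x^α`. -/
def pommaretCone (α : Term n) : Set (Term n) :=
  {β | ∃ δ : Term n, β = δ + α ∧ ∀ i, ¬ IsMultiplicative α i → δ i = 0}

variable {K : Type u} [Field K]

/-- The exponents of the terms in an ideal of `R`. -/
def termsOf (I : Ideal (MvPolynomial (Fin (n + 1)) K)) : Set (Term n) :=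
  {α | monomial α (1 : K) ∈ I}

/-- The finite set `P` of terms is a Pommaret basis of `I`: it generates `I`, and the terms in `I`
are the disjoint union of the Pommaret cones of the elements of `P`. -/
structure IsPommaretBasis (P : Finset (Term n)) (I : Ideal (MvPolynomial (Fin (n + 1)) K)) :
    Prop where
  span_eq : I = Ideal.span ((fun α => monomial α (1 : K)) '' (P : Set (Term n)))
  terms_eq : termsOf I = ⋃ α ∈ P, pommaretCone α
  disjoint : (P : Set (Term n)).PairwiseDisjoint pommaretCone

/-- A quasi-stable ideal: a monomial ideal that has a Pommaret basis. -/
def IsQuasiStable (I : Ideal (MvPolynomial (Fin (n + 1)) K)) : Prop :=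
  ∃ P : Finset (Term n), IsPommaretBasis P I

/-- `I` is saturated with respect to the ideal `(x_0, …, x_n)`. -/
def IsSaturated (I : Ideal (MvPolynomial (Fin (n + 1)) K)) : Prop :=
  ∀ f, (∃ k : ℕ, ∀ g ∈ Ideal.span (Set.range (X : Fin (n + 1) → MvPolynomial (Fin (n + 1)) K)) ^ k,
    g * f ∈ I) → f ∈ I

/-- `x^α >_lex x^β`, for the order `x_0 < ⋯ < x_n` of the variables. -/
def LexGT (α β : Term n) : Prop :=
  ∃ i, β i < α i ∧ ∀ j, i < j → α j = β j

end Monomial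

/-! ### Lex-ideals of `S = R/I` and Macaulay–Lex rings -/

section Lex

variable {n : ℕ} {K : Type u} [Field K] (I : HomogeneousIdeal (stdGrading n K))

/-- The grading of `S = R/I`. -/
abbrev SGrading : ℕ → Submodule K (MvPolynomial (Fin (n + 1)) K ⧸ I.toIdeal) :=
  quotGrading (stdGrading n K) I

/-- The image in `S` of the term `x^α`. -/
def termS (α : Term n) : MvPolynomial (Fin (n + 1)) K ⧸ I.toIdeal :=
  Ideal.Quotient.mk I.toIdeal (monomial α 1)

/-- A lex-ideal `U` of `S`: it is generated by images of terms, and for all (nonzero) terms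
`x^α, x^β` of `S` of the same degree, if `x^α ∈ U` and `x^β >_lex x^α` then `x^β ∈ U`. -/
structure IsLexIdeal (U : HomogeneousIdeal (SGrading I)) : Prop where
  monomial : ∃ W : Set (Term n), U.toIdeal = Ideal.span (termS I '' W)
  lex : ∀ α β : Term n, termS I α ≠ 0 → termS I β ≠ 0 → α.degree = β.degree →
    LexGT β α → termS I α ∈ U → termS I β ∈ U

/-- `S = R/I` is Macaulay–Lex: every homogeneous ideal of `S` has the Hilbert function of some
lex-ideal of `S`. -/
def IsMacaulayLex : Prop :=
  ∀ U : HomogeneousIdeal (SGrading I), ∃ V : HomogeneousIdeal (SGrading I), IsLexIdeal I V ∧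
    ∀ d, idealHilbertFunction (SGrading I) V d = idealHilbertFunction (SGrading I) U d

end Lex

/-! ### Hilbert functions of subschemes of `X = Proj S` -/

section Scheme

variable {n : ℕ} {K : Type u} [Field K] (I : HomogeneousIdeal (stdGrading n K))

/-- `X = Proj S`. -/
abbrev ProjS : Scheme.{u} := Proj (SGrading I)

/-- The image of `x_i` in `S`. -/
def coord (i : Fin (n + 1)) : MvPolynomial (Fin (n + 1)) K ⧸ I.toIdeal :=
  Ideal.Quotient.mk I.toIdeal (X i)

theorem coord_mem (i : Fin (n + 1)) : coord I i ∈ SGrading I 1 :=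
  mk_mem_quotGrading _ I (isHomogeneous_X K i)

/-- The function `x_i / x_j` on the chart `D₊(x_j)` of `X`. -/
def coordRatio (j i : Fin (n + 1)) : Γ(ProjS I, Proj.basicOpen (SGrading I) (coord I j)) :=
  (Proj.awayToSection (SGrading I) (coord I j)).hom
    (HomogeneousLocalization.Away.mk (SGrading I) (coord_mem I j) 1 (coord I i)
      (by simpa using coord_mem I i))

variable {Z : Scheme.{u}} (a : Z ⟶ ProjS I) {L : Type u} [Field L] (b : Z ⟶ Spec (.of L))

/-- For a scheme `Z` over a field `L` with a morphism `a : Z ⟶ X`, the ring homomorphism from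
`L[x_0, …, x_n]` to the functions on `a⁻¹ D₊(x_j)` that sends `x_i` to `x_i / x_j`. It sends
a form `f` of degree `d` to `f / x_j ^ d`. -/
def dehomogenize (j : Fin (n + 1)) :
    MvPolynomial (Fin (n + 1)) L →+*
      Γ(Z, a ⁻¹ᵁ Proj.basicOpen (SGrading I) (coord I j)) :=
  eval₂Hom
    ((Scheme.ΓSpecIso (.of L)).inv ≫ b.appTop ≫ Z.presheaf.map (homOfLE le_top).op).hom
    (fun i => (a.app (Proj.basicOpen (SGrading I) (coord I j))).hom (coordRatio I j i))

/-- The (saturated) homogeneous ideal in `L[x_0, …, x_n]` of a subscheme `Z` of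
`X_L ⊆ ℙⁿ_L`: it is generated by the forms that vanish on `Z`, that is, the forms `f` of any
degree `d` such that `f / x_j ^ d` vanishes on `Z ∩ D₊(x_j)` for every `j`. -/
def subschemeIdeal : HomogeneousIdeal (stdGrading n L) :=
  (⨅ j, RingHom.ker (dehomogenize I a b j)).homogeneousCore (stdGrading n L)

/-- The Hilbert function of a subscheme `Z` of `X_L ⊆ ℙⁿ_L`: the Hilbert function of its
homogeneous coordinate ring. -/
def subschemeHilbertFunction (d : ℕ) : ℕ :=
  quotHilbertFunction (stdGrading n L) (subschemeIdeal I a b) d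

end Scheme

/-! ### The Hilbert scheme of `X = Proj S` -/

section Hilbert

variable {n : ℕ} {K : Type u} [Field K] (I : HomogeneousIdeal (stdGrading n K))

/-- For a morphism `Z ⟶ X × T`, the Hilbert function of the fibre `Z_t`, as a subscheme of
`X_{κ(t)} ⊆ ℙⁿ_{κ(t)}`. -/
def fiberHilbertFunction {Z T : Scheme.{u}} (toX : Z ⟶ ProjS I) (toT : Z ⟶ T) (t : T) (d : ℕ) :
    ℕ :=
  subschemeHilbertFunction I (L := T.residueField t) (toT.fiberι t ≫ toX)
    (toT.fiberToSpecResidueField t) d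

/-- An element of the Hilbert functor of `X` and `p` over the `K`-scheme `π : T ⟶ Spec K`:
a closed subscheme `Z` of `X ×_K T`, flat and locally of finite presentation over `T`, all of
whose fibres have Hilbert polynomial `p`. -/
structure Family (p : Polynomial ℚ) {T : Scheme.{u}} (π : T ⟶ Spec (.of K)) where
  /-- The total space. -/
  Z : Scheme.{u}
  /-- The projection to `X`. -/
  toX : Z ⟶ ProjS I
  /-- The projection to the base. -/
  toT : Z ⟶ T
  comm : toX ≫ projStr (SGrading I) = toT ≫ π
  isClosedImmersion : IsClosedImmersion (pullback.lift toX toT comm)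
  flat : Flat toT
  locallyOfFinitePresentation : LocallyOfFinitePresentation toT
  hilbertPolynomial : ∀ t : T, ∃ N : ℕ, ∀ d ≥ N,
    (fiberHilbertFunction I toX toT t d : ℚ) = p.eval (d : ℚ)

variable {I} {p : Polynomial ℚ}

namespace Family

variable {T H : Scheme.{u}} {π : T ⟶ Spec (.of K)} {η : H ⟶ Spec (.of K)}

/-- The Hilbert function of the member `F_t` of the family. -/
def hilbertFunctionAt (F : Family I p π) (t : T) (d : ℕ) : ℕ :=
  fiberHilbertFunction I F.toX F.toT t d

/-- As closed subschemes of `X ×_K T`, the family `F` is the pullback of `G` along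
`f : T ⟶ H`. -/
def IsPullbackOf (F : Family I p π) (G : Family I p η) (f : T ⟶ H) : Prop :=
  ∃ g : F.Z ⟶ G.Z, g ≫ G.toX = F.toX ∧ IsPullback g F.toT G.toT f

/-- The family `G` over `H` is universal, that is, `H` is the Hilbert scheme of `X` and `p`
(it represents the Hilbert functor) and `G` is its universal family. -/
def IsUniversal (G : Family I p η) : Prop :=
  ∀ ⦃T : Scheme.{u}⦄ (π : T ⟶ Spec (.of K)) (F : Family I p π),
    ∃! f : T ⟶ H, f ≫ η = π ∧ F.IsPullbackOf G f

/-- The closed subscheme `F` of `X` is defined by a lex-ideal `U` of `S`: it is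
`Proj (S/U) ⊆ X`. -/
def IsDefinedByLexIdeal (F : Family I p (𝟙 (Spec (.of K)))) : Prop :=
  ∃ U : HomogeneousIdeal (SGrading I), IsLexIdeal I U ∧
    ∃ e : F.Z ≅ Proj (quotGrading (SGrading I) U), e.hom ≫ projQuotι (SGrading I) U = F.toX

/-- The point `y` of `H` is a `K`-rational point at which the member of the family `G` is
a closed subscheme of `X` defined by a lex-ideal of `S`. -/
def IsLexPoint (G : Family I p η) (y : H) : Prop :=
  ∃ s : Spec (.of K) ⟶ H, s ≫ η = 𝟙 _ ∧ (∀ x, s x = y) ∧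
    ∃ F : Family I p (𝟙 (Spec (.of K))), F.IsDefinedByLexIdeal ∧ F.IsPullbackOf G s

end Family

end Hilbert

end LexPoint

end

/-! A fibre of a family over a point `t` has a homogeneous ideal `J` over `κ(t)` containing the
terms of `I`. Its initial ideal is spanned by terms and has the same Hilbert function, so it can be
read over `K`, where it contains `I`. Macaulay–Lex then gives a lex-ideal `V` of `S` such that `S/V`
has the Hilbert function of the fibre in every degree (`Family.exists_isLexIdeal`). In particular
`Proj (S/V)` has Hilbert polynomial `p`, which gives existence over `K`.

Uniqueness: the terms of a lex-ideal in degree `d` form an initial segment of a total order, so its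
degree `d` part is determined by its dimension (`IsLexIdeal.inf_eq_inf`). Two lex-ideals with the
same Hilbert polynomial therefore agree in large degrees, and `Proj` sees only large degrees
(`ker_projQuotι_le`).

Minimality: if `Y = Proj (S/U)` and `V` belongs to a fibre as above, then `Y = Proj (S/V)` by
uniqueness. The homogeneous ideal of `Y` is the saturation of the preimage of `V`, hence contains
that preimage, so the Hilbert function of `Y` is at most that of `S/V`, which is that of the fibre.

For a representing scheme, a family over `K` is the same as a `K`-rational point, and the residue
field there is `K`, so fibre and pulled back family have the same Hilbert function. -/

namespace LexPoint

/-! ### Leading exponents -/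

section LeadingExponents

variable {σ F : Type*} [Field F]

/-- The leading exponents of the nonzero elements of a space of polynomials. -/
def leadingExponents (m : MonomialOrder σ) (W : Submodule F (MvPolynomial σ F)) : Set (σ →₀ ℕ) :=
  {α | ∃ f ∈ W, f ≠ 0 ∧ m.degree f = α}

/-- Choosing one element of `W` for each leading exponent gives a basis: distinct leading exponents
force independence, and cancelling leading terms terminates because the order is well-founded. In
infinite dimension both sides are `0`. -/
theorem finrank_eq_ncard_leadingExponents (m : MonomialOrder σ)
    (W : Submodule F (MvPolynomial σ F)) :
    Module.finrank F W = (leadingExponents m W).ncard := by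
  classical
  choose v hvW hv0 hv using fun α : leadingExponents m W => α.2
  let b : leadingExponents m W → W := fun α => ⟨v α, hvW α⟩
  have hli : LinearIndependent F b := by
    rw [linearIndependent_iff']
    intro s g hs
    by_contra! hne
    obtain ⟨i, hi, hgi⟩ := hne
    -- At the largest exponent `k` with nonzero coefficient only `v k` contributes to the
    -- coefficient of the sum.
    obtain ⟨k, hk, hmax⟩ := Finset.exists_max_image (s.filter fun i => g i ≠ 0)
      (fun i => m.toSyn i.1) ⟨i, by simp [hi, hgi]⟩
    rw [Finset.mem_filter] at hk
    have h0 : ∑ i ∈ s, g i * coeff k.1 (v i) = 0 := by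
      simpa [b, coeff_sum] using congrArg (fun w : W => coeff k.1 (w : MvPolynomial σ F)) hs
    rw [Finset.sum_eq_single k] at h0
    · refine (mul_ne_zero hk.2 ?_) h0
      conv => arg 1; arg 1; rw [← hv k]
      exact m.coeff_degree_ne_zero_iff.mpr (hv0 k)
    · intro l hl hlk
      by_cases hgl : g l = 0
      · simp [hgl]
      · have hle := hmax l (by simp [hl, hgl])
        have hlt : m.toSyn l.1 < m.toSyn k.1 :=
          lt_of_le_of_ne hle fun h => hlk (Subtype.ext (m.toSyn.injective h))
        rw [m.coeff_eq_zero_of_lt (by rw [hv l]; exact hlt), mul_zero]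
    · intro h
      exact absurd hk.1 h
  have hspan : ⊤ ≤ Submodule.span F (Set.range b) := by
    have key : ∀ (e : m.syn) (w : W), m.toSyn (m.degree (w : MvPolynomial σ F)) = e →
        w ∈ Submodule.span F (Set.range b) := by
      intro e
      induction e using WellFoundedLT.induction with
      | ind e ih =>
        intro w hw
        by_cases hw0 : w = 0
        · rw [hw0]; exact zero_mem _
        have hw0' : (w : MvPolynomial σ F) ≠ 0 := by simpa using hw0
        let α : leadingExponents m W := ⟨m.degree (w : MvPolynomial σ F), w, w.2, hw0', rfl⟩
        have hvd : m.degree (v α) = m.degree (w : MvPolynomial σ F) := hv α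
        have hlc := m.leadingCoeff_ne_zero_iff.mpr (hv0 α)
        -- With this `c` the leading terms of `w` and `c • b α` cancel, so the difference is zero or
        -- has a smaller leading exponent.
        let c := m.leadingCoeff (w : MvPolynomial σ F) / m.leadingCoeff (v α)
        have hw' : w - c • b α ∈ Submodule.span F (Set.range b) := by
          by_cases hz : w - c • b α = 0
          · rw [hz]; exact zero_mem _
          refine ih _ ?_ _ rfl
          rw [← hw]
          have hle : m.toSyn (m.degree ((w - c • b α : W) : MvPolynomial σ F)) ≤
              m.toSyn (m.degree (w : MvPolynomial σ F)) := by
            refine (m.degree_sub_le).trans (sup_le le_rfl ?_)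
            exact (m.degree_smul_le).trans (by simp [b, hvd])
          refine lt_of_le_of_ne hle fun h => ?_
          have h' := m.toSyn.injective h
          have hz' : ((w - c • b α : W) : MvPolynomial σ F) ≠ 0 := fun h0 => hz (Subtype.ext h0)
          refine m.coeff_degree_ne_zero_iff.mpr hz' ?_
          rw [h']
          have h1 : coeff (m.degree (w : MvPolynomial σ F)) (v α) = m.leadingCoeff (v α) := by
            rw [← hvd]; rfl
          have h2 : coeff (m.degree (w : MvPolynomial σ F)) (w : MvPolynomial σ F) =
            m.leadingCoeff (w : MvPolynomial σ F) := rfl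
          simp [b, h1, h2, c, div_mul_cancel₀ _ hlc]
        have := add_mem hw' (Submodule.smul_mem _ c (Submodule.subset_span ⟨α, rfl⟩))
        simpa using this
    exact fun w _ => key _ w rfl
  rw [Module.finrank_eq_nat_card_basis (Module.Basis.mk hli hspan)]
  rfl

end LeadingExponents

/-! ### Hilbert functions of homogeneous ideals -/

section HilbertFunction

variable {K A : Type u} [Field K] [CommRing A] [Algebra K A]
variable (𝒜 : ℕ → Submodule K A) [GradedAlgebra 𝒜] (J : HomogeneousIdeal 𝒜)

theorem finrank_map_add_finrank_inf_ker {K M N : Type*} [Field K] [AddCommGroup M] [Module K M]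
    [AddCommGroup N] [Module K N] (f : M →ₗ[K] N) (W : Submodule K M) [FiniteDimensional K W] :
    Module.finrank K (W.map f) + Module.finrank K ↥(LinearMap.ker f ⊓ W) =
      Module.finrank K W := by
  have h := (f.domRestrict W).finrank_range_add_finrank_ker
  rw [LinearMap.range_domRestrict, LinearMap.ker_domRestrict] at h
  rw [← h, inf_comm, ← Submodule.map_comap_subtype,
    (Submodule.equivMapOfInjective W.subtype W.injective_subtype _).finrank_eq]

theorem ker_mkₐ_toLinearMap :
    LinearMap.ker (Ideal.Quotient.mkₐ K J.toIdeal).toLinearMap = J.toIdeal.restrictScalars K := by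
  ext x
  simp [Ideal.Quotient.eq_zero_iff_mem]

theorem quotHilbertFunction_add_idealHilbertFunction (d : ℕ) [FiniteDimensional K (𝒜 d)] :
    quotHilbertFunction 𝒜 J d + idealHilbertFunction 𝒜 J d = Module.finrank K (𝒜 d) := by
  have h := finrank_map_add_finrank_inf_ker (Ideal.Quotient.mkₐ K J.toIdeal).toLinearMap (𝒜 d)
  rwa [ker_mkₐ_toLinearMap] at h

/-- Rank-nullity for the quotient map on the preimage of `U`, whose kernel is `J`. Hilbert functions
of ideals of `S` and of their preimages in `R` thus carry the same information. -/
theorem idealHilbertFunction_comap (U : HomogeneousIdeal (quotGrading 𝒜 J)) (d : ℕ)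
    [FiniteDimensional K (𝒜 d)] :
    idealHilbertFunction 𝒜 (U.comap (quotMk 𝒜 J)) d =
      idealHilbertFunction (quotGrading 𝒜 J) U d + idealHilbertFunction 𝒜 J d := by
  let W := ((U.comap (quotMk 𝒜 J)).toIdeal.restrictScalars K ⊓ 𝒜 d)
  have : FiniteDimensional K W := Submodule.finiteDimensional_of_le inf_le_right
  have h := finrank_map_add_finrank_inf_ker (Ideal.Quotient.mkₐ K J.toIdeal).toLinearMap W
  rw [ker_mkₐ_toLinearMap] at h
  have h1 : W.map (Ideal.Quotient.mkₐ K J.toIdeal).toLinearMap =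
      U.toIdeal.restrictScalars K ⊓ quotGrading 𝒜 J d := by
    ext x
    constructor
    · rintro ⟨a, ha, rfl⟩
      exact ⟨ha.1, a, ha.2, rfl⟩
    · rintro ⟨hx, a, ha, rfl⟩
      exact ⟨a, ⟨hx, ha⟩, rfl⟩
  have h2 : J.toIdeal.restrictScalars K ⊓ W = J.toIdeal.restrictScalars K ⊓ 𝒜 d := by
    ext x
    constructor
    · exact fun hx => ⟨hx.1, hx.2.2⟩
    · refine fun hx => ⟨hx.1, ?_, hx.2⟩
      change Ideal.Quotient.mk J.toIdeal x ∈ U.toIdeal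
      rw [Ideal.Quotient.eq_zero_iff_mem.mpr hx.1]
      exact zero_mem _
  rw [h1, h2] at h
  exact h.symm

end HilbertFunction

section Std

variable {n : ℕ} {L : Type u} [Field L]

instance finiteDimensional_stdGrading (d : ℕ) : FiniteDimensional L (stdGrading n L d) :=
  Module.Finite.iff_fg.mpr (homogeneousSubmodule_fg (Fin (n + 1)) L d)

theorem degree_lex_of_isHomogeneous {f : MvPolynomial (Fin (n + 1)) L} {d : ℕ}
    (hf : f.IsHomogeneous d) (h0 : f ≠ 0) (m : MonomialOrder (Fin (n + 1))) :
    (m.degree f).degree = d := by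
  by_contra h
  exact m.coeff_degree_ne_zero_iff.mpr h0 (hf.coeff_eq_zero h)

/-- The count does not involve the field, so ideals over `K` and over a residue field become
comparable. -/
theorem finrank_stdGrading (d : ℕ) :
    Module.finrank L (stdGrading n L d) = {α : Term n | α.degree = d}.ncard := by
  rw [finrank_eq_ncard_leadingExponents MonomialOrder.lex]
  congr 1
  ext α
  constructor
  · rintro ⟨f, hf, h0, rfl⟩
    exact degree_lex_of_isHomogeneous hf h0 _
  · intro hα
    refine ⟨monomial α 1, isHomogeneous_monomial 1 hα, by simp, ?_⟩
    classical
    simp [MonomialOrder.degree_monomial]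

end Std

/-! ### Initial ideals -/

section Initial

variable {n : ℕ} {L : Type u} [Field L] (J : HomogeneousIdeal (stdGrading n L))

/-- The lexicographic leading exponents of the nonzero homogeneous elements of `J`. -/
def initialTerms : Set (Term n) :=
  {α | ∃ f ∈ J.toIdeal, f.IsHomogeneous α.degree ∧ f ≠ 0 ∧ MonomialOrder.lex.degree f = α}

/-- Macaulay's theorem: an ideal and its initial ideal have the same Hilbert function. Only this
count is used, so the order `MonomialOrder.lex` need not be compatible with `LexGT`. -/
theorem idealHilbertFunction_eq_ncard (d : ℕ) :
    idealHilbertFunction (stdGrading n L) J d = {α ∈ initialTerms J | α.degree = d}.ncard := by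
  rw [idealHilbertFunction, finrank_eq_ncard_leadingExponents MonomialOrder.lex]
  congr 1
  ext α
  constructor
  · rintro ⟨f, ⟨hf, hd⟩, h0, rfl⟩
    have h := degree_lex_of_isHomogeneous hd h0 MonomialOrder.lex
    exact ⟨⟨f, hf, by rwa [h], h0, rfl⟩, h⟩
  · rintro ⟨⟨f, hf, hd, h0, h⟩, rfl⟩
    exact ⟨f, ⟨hf, hd⟩, h0, h⟩

theorem monomial_mem_initialTerms {α : Term n} (h : monomial α (1 : L) ∈ J.toIdeal) :
    α ∈ initialTerms J := by
  classical
  exact ⟨_, h, isHomogeneous_monomial 1 rfl, by simp, by simp [MonomialOrder.degree_monomial]⟩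

/-- Multiplying by a term translates the leading exponent. -/
theorem isUpperSet_initialTerms : IsUpperSet (initialTerms J) := by
  classical
  rintro _ β hαβ ⟨f, hf, hd, h0, rfl⟩
  obtain ⟨δ, rfl⟩ := exists_add_of_le hαβ
  have hm : monomial δ (1 : L) ≠ 0 := by simp
  refine ⟨f * monomial δ 1, Ideal.mul_mem_right _ _ hf, ?_, mul_ne_zero h0 hm, ?_⟩
  · rw [map_add]
    exact hd.mul (isHomogeneous_monomial 1 rfl)
  · rw [MonomialOrder.degree_mul h0 hm]
    simp [MonomialOrder.degree_monomial]

variable (K : Type u) [Field K]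

/-- The initial ideal of `J`, as an ideal over another field `K`. -/
noncomputable def initialIdeal : HomogeneousIdeal (stdGrading n K) :=
  ⟨Ideal.span ((fun α => monomial α (1 : K)) '' initialTerms J), by
    refine Ideal.homogeneous_span _ _ ?_
    rintro _ ⟨α, -, rfl⟩
    exact ⟨α.degree, isHomogeneous_monomial 1 rfl⟩⟩

variable {K}

theorem mem_initialIdeal {f : MvPolynomial (Fin (n + 1)) K} :
    f ∈ (initialIdeal J K).toIdeal ↔ ∀ α ∈ f.support, α ∈ initialTerms J := by
  refine mem_ideal_span_monomial_image.trans (forall₂_congr fun α _ => ?_)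
  exact ⟨fun ⟨β, hβ, h⟩ => isUpperSet_initialTerms J h hβ, fun h => ⟨α, h, le_rfl⟩⟩

theorem initialTerms_initialIdeal : initialTerms (initialIdeal J K) = initialTerms J := by
  ext α
  constructor
  · rintro ⟨f, hf, hd, h0, rfl⟩
    exact (mem_initialIdeal J).mp hf _ (MonomialOrder.degree_mem_support h0)
  · intro h
    refine monomial_mem_initialTerms _ ((mem_initialIdeal J).mpr fun β hβ => ?_)
    rwa [Finset.mem_singleton.mp (support_monomial_subset hβ)]

theorem idealHilbertFunction_initialIdeal (d : ℕ) :
    idealHilbertFunction (stdGrading n K) (initialIdeal J K) d =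
      idealHilbertFunction (stdGrading n L) J d := by
  rw [idealHilbertFunction_eq_ncard, idealHilbertFunction_eq_ncard, initialTerms_initialIdeal]

end Initial

/-! ### Lex-ideals -/

section Lex

variable {n : ℕ} {K : Type u} [Field K] {I : HomogeneousIdeal (stdGrading n K)}

/-- If `S = R/I` is Macaulay–Lex and `I` is a monomial ideal, then every homogeneous ideal over an
extension field that contains the terms of `I` has the Hilbert function of a lex-ideal of `S`. -/
theorem exists_isLexIdeal (hqs : IsQuasiStable I.toIdeal) (hML : IsMacaulayLex I)
    {L : Type u} [Field L] (J : HomogeneousIdeal (stdGrading n L))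
    (hJ : ∀ α : Term n, monomial α (1 : K) ∈ I.toIdeal → monomial α (1 : L) ∈ J.toIdeal) :
    ∃ V : HomogeneousIdeal (SGrading I), IsLexIdeal I V ∧
      ∀ d, idealHilbertFunction (stdGrading n K) (V.comap (quotMk _ I)) d =
        idealHilbertFunction (stdGrading n L) J d := by
  obtain ⟨P, hP⟩ := hqs
  -- A Pommaret basis generates `I` by terms, and for terms the inclusion is `hJ`.
  have hI : I.toIdeal ≤ (initialIdeal J K).toIdeal := by
    rw [hP.span_eq, Ideal.span_le]
    rintro _ ⟨α, hα, rfl⟩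
    refine Ideal.subset_span ⟨α, monomial_mem_initialTerms J (hJ α ?_), rfl⟩
    rw [hP.span_eq]
    exact Ideal.subset_span ⟨α, hα, rfl⟩
  obtain ⟨V, hV, hVd⟩ := hML ((initialIdeal J K).map (quotMk _ I))
  refine ⟨V, hV, fun d => ?_⟩
  have hcomap : ((initialIdeal J K).map (quotMk _ I)).comap (quotMk _ I) = initialIdeal J K := by
    apply HomogeneousIdeal.toIdeal_injective
    change ((initialIdeal J K).toIdeal.map (Ideal.Quotient.mk I.toIdeal)).comap
      (Ideal.Quotient.mk I.toIdeal) = _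
    rw [Ideal.comap_map_of_surjective' _ Ideal.Quotient.mk_surjective, Ideal.mk_ker]
    exact sup_eq_left.mpr hI
  rw [idealHilbertFunction_comap, hVd, ← idealHilbertFunction_comap, hcomap,
    idealHilbertFunction_initialIdeal]

theorem lexGT_trichotomy {α β : Term n} (h : α ≠ β) : LexGT α β ∨ LexGT β α := by
  have hne : (Finset.univ.filter fun i => α i ≠ β i).Nonempty := by
    obtain ⟨i, hi⟩ := Finsupp.ne_iff.mp h
    exact ⟨i, by simpa using hi⟩
  -- The largest index at which the exponents differ decides the comparison.
  obtain ⟨i, hi, hmax⟩ := Finset.exists_max_image _ id hne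
  have heq : ∀ j, i < j → α j = β j := by
    intro j hj
    by_contra hjne
    exact absurd (hmax j (by simpa using hjne)) (not_le.mpr hj)
  rcases lt_or_gt_of_ne (by simpa using hi : α i ≠ β i) with hlt | hlt
  · exact Or.inr ⟨i, hlt, fun j hj => (heq j hj).symm⟩
  · exact Or.inl ⟨i, hlt, heq⟩

/-- The graded pieces of an ideal generated by terms are spanned by terms. -/
theorem IsLexIdeal.inf_le_span {U : HomogeneousIdeal (SGrading I)} (hU : IsLexIdeal I U) (d : ℕ) :
    U.toIdeal.restrictScalars K ⊓ SGrading I d ≤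
      Submodule.span K (termS I '' {α | α.degree = d ∧ termS I α ≠ 0 ∧ termS I α ∈ U}) := by
  obtain ⟨W, hW⟩ := hU.monomial
  set N := Submodule.span K (termS I '' {α | α.degree = d ∧ termS I α ≠ 0 ∧ termS I α ∈ U})
  have hmul : ∀ α β : Term n, termS I α * termS I β = termS I (α + β) := by
    intro α β
    rw [termS, termS, termS, ← map_mul, monomial_mul, one_mul]
  have hdec : ∀ α : Term n, termS I α ∈ U → (DirectSum.decompose (SGrading I) (termS I α) d :
      MvPolynomial (Fin (n + 1)) K ⧸ I.toIdeal) ∈ N := by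
    intro α hα
    have hmem : termS I α ∈ SGrading I α.degree :=
      mk_mem_quotGrading _ I (isHomogeneous_monomial 1 rfl)
    by_cases hd : α.degree = d
    · subst hd
      rw [DirectSum.decompose_of_mem_same _ hmem]
      by_cases h0 : termS I α = 0
      · rw [h0]; exact zero_mem _
      · exact Submodule.subset_span ⟨α, ⟨rfl, h0, hα⟩, rfl⟩
    · rw [DirectSum.decompose_of_mem_ne _ hmem hd]
      exact zero_mem _
  have hmulmem : ∀ (α : Term n), termS I α ∈ U → ∀ r : MvPolynomial (Fin (n + 1)) K,
      (DirectSum.decompose (SGrading I) (Ideal.Quotient.mk I.toIdeal r * termS I α) d :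
        MvPolynomial (Fin (n + 1)) K ⧸ I.toIdeal) ∈ N := by
    intro α hα r
    induction r using MvPolynomial.induction_on' with
    | monomial β b =>
      have : Ideal.Quotient.mk I.toIdeal (MvPolynomial.monomial β b) * termS I α =
          b • termS I (β + α) := by
        rw [← hmul, ← smul_mul_assoc]
        congr 1
        rw [termS, ← Ideal.Quotient.mkₐ_eq_mk K, ← map_smul, smul_monomial, smul_eq_mul, mul_one]
      rw [this, DirectSum.decompose_smul]
      refine N.smul_mem b (hdec _ ?_)
      rw [← hmul]
      exact Ideal.mul_mem_left _ _ hα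
    | add p q hp hq =>
      rw [map_add, add_mul, DirectSum.decompose_add]
      exact add_mem hp hq
  -- The multiplier `r` is part of the claim so that scalars met in the span induction can be
  -- absorbed into it; `r = 1` is used at the end.
  have hall : ∀ x ∈ U.toIdeal, ∀ r : MvPolynomial (Fin (n + 1)) K,
      (DirectSum.decompose (SGrading I) (Ideal.Quotient.mk I.toIdeal r * x) d :
        MvPolynomial (Fin (n + 1)) K ⧸ I.toIdeal) ∈ N := by
    intro x hx
    rw [hW] at hx
    induction hx using Submodule.span_induction with
    | mem x hx =>
      obtain ⟨α, hα, rfl⟩ := hx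
      refine hmulmem α ?_
      change _ ∈ U.toIdeal
      rw [hW]
      exact Ideal.subset_span ⟨α, hα, rfl⟩
    | zero => simp
    | add x y _ _ hx hy =>
      intro r
      rw [mul_add, DirectSum.decompose_add]
      exact add_mem (hx r) (hy r)
    | smul s x _ hx =>
      intro r
      obtain ⟨t, rfl⟩ := Ideal.Quotient.mk_surjective s
      rw [smul_eq_mul, ← mul_assoc, ← map_mul]
      exact hx _
  rintro x ⟨hx, hd⟩
  have := hall x hx 1
  rwa [map_one, one_mul, DirectSum.decompose_of_mem_same _ hd] at this

/-- Totality of the lex order makes the sets of degree `d` terms of two lex-ideals nested, and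
nested spaces of equal finite dimension coincide. -/
theorem IsLexIdeal.inf_eq_inf {U V : HomogeneousIdeal (SGrading I)} (hU : IsLexIdeal I U)
    (hV : IsLexIdeal I V) {d : ℕ}
    (h : idealHilbertFunction (SGrading I) U d = idealHilbertFunction (SGrading I) V d) :
    U.toIdeal.restrictScalars K ⊓ SGrading I d = V.toIdeal.restrictScalars K ⊓ SGrading I d := by
  have hfd : FiniteDimensional K (SGrading I d) :=
    Module.Finite.map (stdGrading n K d) _
  let A (U : HomogeneousIdeal (SGrading I)) : Set (Term n) :=
    {α | α.degree = d ∧ termS I α ≠ 0 ∧ termS I α ∈ U}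
  have key : ∀ {U V : HomogeneousIdeal (SGrading I)}, IsLexIdeal I U → A U ⊆ A V →
      U.toIdeal.restrictScalars K ⊓ SGrading I d ≤ V.toIdeal.restrictScalars K ⊓ SGrading I d := by
    intro U V hU hUV
    refine (hU.inf_le_span d).trans (Submodule.span_le.mpr ?_)
    rintro _ ⟨α, hα, rfl⟩
    exact ⟨(hUV hα).2.2, mk_mem_quotGrading _ I (isHomogeneous_monomial 1 hα.1)⟩
  have hfin : ∀ U : HomogeneousIdeal (SGrading I),
      FiniteDimensional K ↥(U.toIdeal.restrictScalars K ⊓ SGrading I d) := fun U =>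
    Submodule.finiteDimensional_of_le inf_le_right
  by_cases hUV : A U ⊆ A V
  · have := hfin V
    exact Submodule.eq_of_le_of_finrank_eq (key hU hUV) h
  · have := hfin U
    refine (Submodule.eq_of_le_of_finrank_eq (key hV fun β hβ => ?_) h.symm).symm
    -- A term `β` of `V` cannot lie below `α`, since that would put `α` into `V`; hence it lies
    -- above `α`, and so in `U`.
    obtain ⟨α, hαU, hαV⟩ := Set.not_subset.mp hUV
    refine ⟨hβ.1, hβ.2.1, ?_⟩
    have hne : α ≠ β := fun h => hαV (h ▸ hβ)
    rcases lexGT_trichotomy hne with hgt | hgt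
    · exact absurd ⟨hαU.1, hαU.2.1, hV.lex β α hβ.2.1 hαU.2.1 (hβ.1.trans hαU.1.symm) hgt hβ.2.2⟩ hαV
    · exact hU.lex α β hαU.2.1 hβ.2.1 (hαU.1.trans hβ.1.symm) hgt hαU.2.2

end Lex

/-! ### Saturation -/

section Saturation

variable {n : ℕ} {K : Type u} [Field K]

/-- Pigeonhole: a term of degree at least `∑ j, N j` is divisible by some `X j ^ N j`. -/
theorem exists_forall_isHomogeneous_mul_mem {M : Ideal (MvPolynomial (Fin (n + 1)) K)}
    {g : MvPolynomial (Fin (n + 1)) K} (h : ∀ j, ∃ N, X j ^ N * g ∈ M) :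
    ∃ D, ∀ d ≥ D, ∀ f : MvPolynomial (Fin (n + 1)) K, f.IsHomogeneous d → f * g ∈ M := by
  choose N hN using h
  refine ⟨∑ j, N j, fun d hd f hf => ?_⟩
  rw [f.as_sum, Finset.sum_mul]
  refine Ideal.sum_mem _ fun α hα => ?_
  have hαd : α.degree = d := by
    by_contra hne
    exact mem_support_iff.mp hα (hf.coeff_eq_zero hne)
  obtain ⟨j, hj⟩ : ∃ j, N j ≤ α j := by
    by_contra! hlt
    have : ∑ j, α j < ∑ j, N j := Finset.sum_lt_sum_of_nonempty Finset.univ_nonempty fun j _ => hlt j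
    rw [← Finsupp.degree_eq_sum, hαd] at this
    exact absurd hd (not_le.mpr this)
  have : monomial α (coeff α f) * g =
      monomial (α - Finsupp.single j (N j)) (coeff α f) * (X j ^ N j * g) := by
    rw [← mul_assoc, X_pow_eq_monomial, monomial_mul, mul_one,
      tsub_add_cancel_of_le (Finsupp.single_le_iff.mpr hj)]
  rw [this]
  exact Ideal.mul_mem_left _ _ (hN j)

/-- If `J` lies in the saturation of `M`, then `J` is contained in `M` in all large degrees. -/
theorem exists_forall_isHomogeneous_mem {J M : HomogeneousIdeal (stdGrading n K)}
    (h : ∀ f ∈ J.toIdeal, ∀ j, ∃ N, X j ^ N * f ∈ M.toIdeal) :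
    ∃ D, ∀ d ≥ D, ∀ f ∈ J.toIdeal, f.IsHomogeneous d → f ∈ M.toIdeal := by
  classical
  have hfg : (Ideal.homogeneousCore' (stdGrading n K) J.toIdeal).FG := IsNoetherian.noetherian _
  have hJ : J.toIdeal = Ideal.homogeneousCore' (stdGrading n K) J.toIdeal :=
    (congrArg HomogeneousIdeal.toIdeal (J.toIdeal_homogeneousCore_eq_self)).symm
  obtain ⟨G, hG, hspan⟩ := (Submodule.fg_span_iff_fg_span_finset_subset _).mp hfg
  replace hJ := hJ.trans hspan
  have hGJ : ∀ g ∈ G, g ∈ J.toIdeal := fun g hg => hJ ▸ Submodule.subset_span hg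
  have hGh : ∀ g ∈ G, SetLike.IsHomogeneousElem (stdGrading n K) g := by
    intro g hg
    obtain ⟨x, -, rfl⟩ := hG hg
    exact x.2
  choose e he using hGh
  choose D hD using fun g hg => exists_forall_isHomogeneous_mul_mem (h g (hGJ g hg))
  -- For each generator `g`, of degree `e g`, the cofactor in degree `d` then has degree `d - e g ≥
  -- D g`; the sum serves as a common upper bound.
  refine ⟨∑ g ∈ G.attach, (e g.1 g.2 + D g.1 g.2), fun d hd f hf hfd => ?_⟩
  rw [hJ] at hf
  obtain ⟨c, -, hc⟩ := Submodule.mem_span_finset.mp hf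
  have hf' : f = ∑ g ∈ G, (DirectSum.decompose (stdGrading n K) (c g * g) d :
      MvPolynomial (Fin (n + 1)) K) := by
    rw [← DirectSum.decompose_of_mem_same (stdGrading n K) hfd, ← hc, DirectSum.decompose_sum,
      DFinsupp.finsetSum_apply, AddSubmonoidClass.coe_finsetSum]
    rfl
  rw [hf']
  refine Ideal.sum_mem _ fun g hg => ?_
  have hle : e g hg + D g hg ≤ d :=
    (Finset.single_le_sum (f := fun g : G => e g.1 g.2 + D g.1 g.2) (fun _ _ => Nat.zero_le _)
      (Finset.mem_attach _ ⟨g, hg⟩)).trans hd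
  rw [DirectSum.coe_decompose_mul_of_right_mem_of_le _ (he g hg) ((Nat.le_add_right _ _).trans hle)]
  exact hD g hg (d - e g hg) (by omega) _ (DirectSum.decompose (stdGrading n K) (c g) _).2

end Saturation

/-! ### Closed subschemes of `Proj` defined by homogeneous ideals -/

section ProjQuot

variable {K A : Type u} [Field K] [CommRing A] [Algebra K A]
variable (𝒜 : ℕ → Submodule K A) [GradedAlgebra 𝒜] (J : HomogeneousIdeal 𝒜)

theorem projQuotι_app_awayToSection {i : ℕ} {s : A} (hs : s ∈ 𝒜 i)
    (x : HomogeneousLocalization.Away 𝒜 s) :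
    ((projQuotι 𝒜 J).app (Proj.basicOpen 𝒜 s)).hom ((Proj.awayToSection 𝒜 s).hom x) =
      (Proj.awayToSection (quotGrading 𝒜 J) (quotMk 𝒜 J s)).hom
        (HomogeneousLocalization.Away.map (quotMk 𝒜 J) s x) := by
  have h := Proj.awayToSection_comp_appLE (quotMk 𝒜 J) (irrelevant_le_map_quotMk 𝒜 J) hs
  rw [Scheme.Hom.app_eq_appLE]
  exact congrArg (fun f => f.hom x) h

theorem awayToSection_bijective {i : ℕ} {s : A} (hs : s ∈ 𝒜 i) (hi : 0 < i) :
    Function.Bijective (Proj.awayToSection 𝒜 s).hom :=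
  ConcreteCategory.bijective_of_isIso (Proj.basicOpenIsoAway 𝒜 s hs hi).hom

theorem awayMk_eq_zero_iff {i : ℕ} {s : A} (hs : s ∈ 𝒜 i) (d : ℕ) {x : A} (hx : x ∈ 𝒜 (d • i)) :
    HomogeneousLocalization.Away.mk 𝒜 hs d x hx = 0 ↔ ∃ N : ℕ, s ^ N * x = 0 := by
  rw [HomogeneousLocalization.ext_iff_val, HomogeneousLocalization.Away.val_mk,
    HomogeneousLocalization.val_zero, Localization.mk_eq_mk', IsLocalization.mk'_eq_zero_iff]
  exact ⟨fun ⟨⟨_, N, rfl⟩, h⟩ => ⟨N, h⟩, fun ⟨N, h⟩ => ⟨⟨_, N, rfl⟩, h⟩⟩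

/-- On `D₊(s)` the morphism is the map of degree zero localizations, and a fraction is zero there
when a power of `s` kills its numerator. This is where saturation enters. -/
theorem projQuotι_app_eq_zero_iff {i : ℕ} {s : A} (hs : s ∈ 𝒜 i) (hi : 0 < i) (d : ℕ) {x : A}
    (hx : x ∈ 𝒜 (d • i)) :
    ((projQuotι 𝒜 J).app (Proj.basicOpen 𝒜 s)).hom ((Proj.awayToSection 𝒜 s).hom
      (HomogeneousLocalization.Away.mk 𝒜 hs d x hx)) = 0 ↔ ∃ N : ℕ, s ^ N * x ∈ J.toIdeal := by
  rw [projQuotι_app_awayToSection 𝒜 J hs, HomogeneousLocalization.Away.map_mk]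
  refine ((map_eq_zero_iff _ (awayToSection_bijective _ ((quotMk 𝒜 J).map_mem hs) hi).1).trans
    (awayMk_eq_zero_iff _ _ _ _)).trans ?_
  refine exists_congr fun N => ?_
  rw [← Ideal.Quotient.eq_zero_iff_mem, map_mul, map_pow]
  rfl

theorem projQuotι_app_surjective {i : ℕ} {s : A} (hs : s ∈ 𝒜 i) (hi : 0 < i) :
    Function.Surjective ((projQuotι 𝒜 J).app (Proj.basicOpen 𝒜 s)).hom := by
  intro y
  obtain ⟨z, rfl⟩ := (awayToSection_bijective _ ((quotMk 𝒜 J).map_mem hs) hi).2 y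
  obtain ⟨d, a, ⟨x, hx, rfl⟩, rfl⟩ := HomogeneousLocalization.Away.mk_surjective _
    ((quotMk 𝒜 J).map_mem hs) z
  refine ⟨(Proj.awayToSection 𝒜 s).hom (HomogeneousLocalization.Away.mk 𝒜 hs d x hx), ?_⟩
  rw [projQuotι_app_awayToSection 𝒜 J hs, HomogeneousLocalization.Away.map_mk]
  rfl

theorem iSup_basicOpen_homogeneous_eq_top :
    ⨆ s : Σ i : ℕ+, 𝒜 i, Proj.basicOpen 𝒜 (s.2 : A) = ⊤ := by
  refine Proj.iSup_basicOpen_eq_top 𝒜 _ ?_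
  rw [HomogeneousIdeal.irrelevant_eq_span]
  refine Ideal.span_mono ?_
  intro x hx
  simp only [Set.mem_iUnion] at hx
  obtain ⟨d, hd, hx⟩ := hx
  exact ⟨⟨⟨d, hd⟩, ⟨x, hx⟩⟩, rfl⟩

/-- Local on the target: over each affine chart `D₊(s)` it comes from a surjection of rings. -/
instance isClosedImmersion_projQuotι : IsClosedImmersion (projQuotι 𝒜 J) := by
  rw [IsZariskiLocalAtTarget.iff_of_iSup_eq_top (P := @IsClosedImmersion) _
    (iSup_basicOpen_homogeneous_eq_top 𝒜)]
  rintro ⟨i, s⟩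
  have h1 : IsAffine (Proj.basicOpen 𝒜 (s : A)) := Proj.isAffineOpen_basicOpen 𝒜 _ s.2 i.2
  have h2 : IsAffine (projQuotι 𝒜 J ⁻¹ᵁ Proj.basicOpen 𝒜 (s : A)) :=
    Proj.isAffineOpen_basicOpen (quotGrading 𝒜 J) _ ((quotMk 𝒜 J).map_mem s.2) i.2
  refine IsClosedImmersion.of_surjective_of_isAffine _ ?_
  rw [morphismRestrict_appTop]
  have hU : Function.Surjective ((projQuotι 𝒜 J).app
      ((Proj.basicOpen 𝒜 (s : A)).ι ''ᵁ ⊤)).hom := by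
    rw [Scheme.Opens.ι_image_top]
    exact projQuotι_app_surjective 𝒜 J s.2 i.2
  exact (ConcreteCategory.bijective_of_isIso
    ((Proj (quotGrading 𝒜 J)).presheaf.map (eqToHom _).op)).2.comp hU

-- Since `x / s ^ d = s ^ N * x / s ^ (d + N)`, every section on a chart has numerators of
-- arbitrarily large degree, so the subscheme depends only on the ideal in large degrees.
variable {𝒜} in
theorem ker_projQuotι_le {U V : HomogeneousIdeal 𝒜} {D : ℕ}
    (h : ∀ d ≥ D, ∀ x ∈ 𝒜 d, x ∈ U.toIdeal → x ∈ V.toIdeal) :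
    (projQuotι 𝒜 U).ker ≤ (projQuotι 𝒜 V).ker := by
  refine Scheme.IdealSheafData.le_of_iSup_eq_top
    (fun s : Σ i : ℕ+, 𝒜 i => ⟨Proj.basicOpen 𝒜 (s.2 : A),
      Proj.isAffineOpen_basicOpen _ _ s.2.2 s.1.2⟩)
    (iSup_basicOpen_homogeneous_eq_top 𝒜) ?_
  rintro ⟨i, s, hs⟩
  refine (Scheme.Hom.ker_apply (projQuotι 𝒜 U) _).le.trans
    (le_trans ?_ (Scheme.Hom.ker_apply (projQuotι 𝒜 V) _).ge)
  intro y hy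
  obtain ⟨z, rfl⟩ := (awayToSection_bijective 𝒜 hs i.2).2 y
  obtain ⟨d, x, hx, rfl⟩ := HomogeneousLocalization.Away.mk_surjective _ hs z
  obtain ⟨N, hN⟩ := (projQuotι_app_eq_zero_iff _ U hs i.2 d hx).mp hy
  -- The factor `s ^ N` brings `x` into `U`; the factor `s ^ D` raises the degree to at least `D`,
  -- because `s` has positive degree.
  refine (projQuotι_app_eq_zero_iff _ V hs i.2 d hx).mpr ⟨D + N, h _ ?_ _
    (SetLike.mul_mem_graded (SetLike.pow_mem_graded _ hs) hx) ?_⟩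
  · have := Nat.mul_le_mul_left (D + N) (show 1 ≤ (i : ℕ) from i.2)
    simp only [smul_eq_mul]
    omega
  · rw [pow_add, mul_assoc]
    exact Ideal.mul_mem_left _ _ hN

theorem awayι_projStr {i : ℕ} {s : A} (hs : s ∈ 𝒜 i) (hi : 0 < i) :
    Proj.awayι 𝒜 s hs hi ≫ projStr 𝒜 =
      Spec.map (CommRingCat.ofHom ((HomogeneousLocalization.fromZeroRingHom 𝒜 (.powers s)).comp
        (algebraMap K (𝒜 0)))) := by
  rw [projStr, Proj.awayι_toSpecZero_assoc, ← Spec.map_comp]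
  rfl

theorem projQuotι_projStr : projQuotι 𝒜 J ≫ projStr 𝒜 = projStr (quotGrading 𝒜 J) := by
  refine (Proj.mapAffineOpenCover (quotMk 𝒜 J)
    (irrelevant_le_map_quotMk 𝒜 J)).openCover.hom_ext _ _ fun s => ?_
  refine (Proj.awayι_comp_map_assoc (quotMk 𝒜 J) (irrelevant_le_map_quotMk 𝒜 J) s.1.2 _ s.2.2
    _).trans ?_
  refine Eq.trans ?_ (awayι_projStr (quotGrading 𝒜 J) ((quotMk 𝒜 J).map_mem s.2.2) s.1.2).symm
  refine (congrArg (fun f => _ ≫ f) (awayι_projStr 𝒜 s.2.2 s.1.2)).trans ?_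
  rw [← Spec.map_comp]
  congr 1

theorem projStr_chart {i : ℕ} {s : A} (hs : s ∈ 𝒜 i) (hi : 0 < i) :
    (Scheme.ΓSpecIso (.of K)).inv ≫ (projStr 𝒜).appTop ≫
        (Proj 𝒜).presheaf.map (homOfLE (le_top : Proj.basicOpen 𝒜 s ≤ ⊤)).op =
      CommRingCat.ofHom ((HomogeneousLocalization.fromZeroRingHom 𝒜 (.powers s)).comp
        (algebraMap K (𝒜 0))) ≫ Proj.awayToSection 𝒜 s := by
  have h : (Proj.basicOpen 𝒜 s).ι ≫ projStr 𝒜 = (Proj.basicOpen 𝒜 s).toSpecΓ ≫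
      Spec.map (CommRingCat.ofHom ((HomogeneousLocalization.fromZeroRingHom 𝒜 (.powers s)).comp
        (algebraMap K (𝒜 0))) ≫ Proj.awayToSection 𝒜 s) := by
    have := Proj.awayι_toSpecZero 𝒜 s hs hi
    rw [← Proj.basicOpenIsoSpec_inv_ι, Category.assoc, Iso.inv_comp_eq,
      Proj.basicOpenIsoSpec_hom, Proj.basicOpenToSpec] at this
    rw [projStr, reassoc_of% this]
    simp [CommRingCat.ofHom_comp]
  have h' := congrArg (fun f => (Scheme.ΓSpecIso (.of K)).inv ≫ f.appTop ≫
    (Proj.basicOpen 𝒜 s).topIso.hom) h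
  simp only [Scheme.Hom.comp_appTop, Category.assoc, Scheme.Opens.toSpecΓ_appTop, Iso.inv_hom_id,
    Category.comp_id] at h'
  rw [← Scheme.ΓSpecIso_inv_naturality_assoc, Iso.inv_hom_id, Category.comp_id] at h'
  rw [← h', Scheme.Opens.ι_appTop, Scheme.Opens.topIso_hom]
  exact congrArg (fun f => _ ≫ _ ≫ f) (Functor.map_comp _ _ _)

end ProjQuot

/-! ### Finiteness of the structure morphism -/

section FiniteType

variable {K A : Type u} [Field K] [CommRing A] [Algebra K A]
variable (𝒜 : ℕ → Submodule K A) [GradedAlgebra 𝒜]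

theorem locallyOfFiniteType_projStr [Algebra.FiniteType K A] [FiniteDimensional K (𝒜 0)] :
    LocallyOfFiniteType (projStr 𝒜) := by
  have : IsScalarTower K (𝒜 0) A := ⟨fun r x y => smul_mul_assoc r (x : A) y⟩
  have : Algebra.FiniteType (𝒜 0) A := Algebra.FiniteType.of_restrictScalars_finiteType K (𝒜 0) A
  have : LocallyOfFiniteType (Spec.map (CommRingCat.ofHom (algebraMap K (𝒜 0)))) := by
    rw [HasRingHomProperty.Spec_iff (P := @LocallyOfFiniteType)]
    exact RingHom.finiteType_algebraMap.mpr inferInstance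
  exact inferInstanceAs (LocallyOfFiniteType (_ ≫ _))

end FiniteType

/-! ### Vanishing of forms on subschemes of `X` -/

section Dehomogenize

variable {n : ℕ} {K : Type u} [Field K] (I : HomogeneousIdeal (stdGrading n K))

instance finiteDimensional_SGrading (d : ℕ) : FiniteDimensional K (SGrading I d) :=
  Module.Finite.map (stdGrading n K d) _

/-- The function `f / x_j ^ d` on `D₊(x_j)`, for a form `f` of degree `d`. -/
noncomputable def awayForm (j : Fin (n + 1)) {f : MvPolynomial (Fin (n + 1)) K} {d : ℕ}
    (hf : f.IsHomogeneous d) : HomogeneousLocalization.Away (SGrading I) (coord I j) :=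
  HomogeneousLocalization.Away.mk (SGrading I) (coord_mem I j) d (Ideal.Quotient.mk I.toIdeal f)
    (by simpa using mk_mem_quotGrading _ I hf)

/-- Dehomogenization with respect to `x_j`. -/
noncomputable def toAway (j : Fin (n + 1)) :
    MvPolynomial (Fin (n + 1)) K →+* HomogeneousLocalization.Away (SGrading I) (coord I j) :=
  eval₂Hom ((HomogeneousLocalization.fromZeroRingHom (SGrading I) (.powers (coord I j))).comp
      (algebraMap K (SGrading I 0)))
    fun i => awayForm I j (isHomogeneous_X K i)

/-- In the full localization a term of degree `d` acquires the factor `(1 / x_j) ^ d`; homogeneity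
makes this factor common to all terms of `f`. -/
theorem toAway_eq_awayForm (j : Fin (n + 1)) {f : MvPolynomial (Fin (n + 1)) K} {d : ℕ}
    (hf : f.IsHomogeneous d) : toAway I j f = awayForm I j hf := by
  apply HomogeneousLocalization.val_injective
  have hX : ∀ i, (awayForm I j (isHomogeneous_X K i)).val =
      algebraMap _ (Localization.Away (coord I j)) (coord I i) *
        IsLocalization.mk' _ 1 ⟨coord I j, Submonoid.mem_powers _⟩ := by
    intro i
    rw [awayForm, HomogeneousLocalization.Away.val_mk, Localization.mk_eq_mk',
      ← IsLocalization.mk'_eq_mul_mk'_one]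
    congr 1
    exact Subtype.ext (pow_one _)
  have hmon : ∀ (α : Term n) (c : K), (toAway I j (monomial α c)).val =
      algebraMap _ (Localization.Away (coord I j)) (Ideal.Quotient.mk I.toIdeal (monomial α c)) *
        (IsLocalization.mk' (Localization.Away (coord I j)) 1
          ⟨coord I j, Submonoid.mem_powers (coord I j)⟩) ^ α.degree := by
    intro α c
    rw [toAway, coe_eval₂Hom, eval₂_monomial, HomogeneousLocalization.val_mul,
      monomial_eq, map_mul, map_mul, mul_assoc]
    congr 1
    rw [← HomogeneousLocalization.algebraMap_apply, Finsupp.prod, Finsupp.prod, map_prod,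
      map_prod, map_prod, Finsupp.degree_apply, ← Finset.prod_pow_eq_pow_sum,
      ← Finset.prod_mul_distrib]
    refine Finset.prod_congr rfl fun i _ => ?_
    rw [map_pow, HomogeneousLocalization.algebraMap_apply, hX, mul_pow, map_pow, map_pow]
    rfl
  rw [awayForm, HomogeneousLocalization.Away.val_mk, Localization.mk_eq_mk',
    IsLocalization.mk'_eq_mul_mk'_one]
  have hpow : IsLocalization.mk' (Localization.Away (coord I j)) 1
      (⟨coord I j ^ d, ⟨d, rfl⟩⟩ : Submonoid.powers (coord I j)) =
      (IsLocalization.mk' (Localization.Away (coord I j)) 1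
          ⟨coord I j, Submonoid.mem_powers (coord I j)⟩) ^ d := by
    rw [← IsLocalization.mk'_pow, one_pow]
    rfl
  rw [hpow]
  conv_lhs => rw [f.as_sum, map_sum, ← HomogeneousLocalization.algebraMap_apply, map_sum]
  conv_rhs => rw [f.as_sum, map_sum, map_sum, Finset.sum_mul]
  refine Finset.sum_congr rfl fun α hα => ?_
  have hαd : α.degree = d := by
    by_contra hne
    exact mem_support_iff.mp hα (hf.coeff_eq_zero hne)
  rw [HomogeneousLocalization.algebraMap_apply, hmon, hαd]

variable {I} {Z : Scheme.{u}} {a : Z ⟶ ProjS I} {L : Type u} [Field L] {b : Z ⟶ Spec (.of L)}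

/-- Both sides come from ring homomorphisms on `K[x_0, …, x_n]`, so constants and variables suffice;
on constants this is the compatibility `h` over `Spec K`. -/
theorem dehomogenize_map {φ : K →+* L}
    (h : b ≫ Spec.map (CommRingCat.ofHom φ) = a ≫ projStr (SGrading I)) (j : Fin (n + 1))
    {f : MvPolynomial (Fin (n + 1)) K} {d : ℕ} (hf : f.IsHomogeneous d) :
    dehomogenize I a b j (map φ f) =
      (a.app (Proj.basicOpen (SGrading I) (coord I j))).hom
        ((Proj.awayToSection (SGrading I) (coord I j)).hom (awayForm I j hf)) := by
  rw [← toAway_eq_awayForm]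
  suffices H : (dehomogenize I a b j).comp (map φ) =
      ((a.app (Proj.basicOpen (SGrading I) (coord I j))).hom.comp
        (Proj.awayToSection (SGrading I) (coord I j)).hom).comp (toAway I j) from
    congrArg (fun g => g f) H
  refine MvPolynomial.ringHom_ext (fun c => ?_) fun i => ?_
  · have h1 : CommRingCat.ofHom φ ≫ (Scheme.ΓSpecIso (.of L)).inv ≫ b.appTop ≫
        Z.presheaf.map (homOfLE (le_top :
          a ⁻¹ᵁ Proj.basicOpen (SGrading I) (coord I j) ≤ ⊤)).op =
        CommRingCat.ofHom ((HomogeneousLocalization.fromZeroRingHom (SGrading I)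
          (.powers (coord I j))).comp (algebraMap K (SGrading I 0))) ≫
        Proj.awayToSection (SGrading I) (coord I j) ≫
        a.app (Proj.basicOpen (SGrading I) (coord I j)) := by
      rw [← reassoc_of% projStr_chart (SGrading I) (coord_mem I j) one_pos,
        Scheme.ΓSpecIso_inv_naturality_assoc, ← Scheme.Hom.comp_appTop_assoc, h,
        Scheme.Hom.comp_appTop_assoc, Scheme.Hom.naturality]
      rfl
    have h2 := congrArg (fun g => g.hom c) h1
    simp only [RingHom.comp_apply, map_C, dehomogenize, toAway, coe_eval₂Hom, eval₂_C]
    exact h2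
  · simp only [RingHom.comp_apply, map_X, dehomogenize, toAway, coe_eval₂Hom, eval₂_X]
    rfl

theorem mem_subschemeIdeal_iff {f : MvPolynomial (Fin (n + 1)) L} {d : ℕ}
    (hf : f.IsHomogeneous d) :
    f ∈ (subschemeIdeal I a b).toIdeal ↔ ∀ j, dehomogenize I a b j f = 0 := by
  constructor
  · intro h j
    exact (Submodule.mem_iInf _).mp (Ideal.toIdeal_homogeneousCore_le _ _ h) j
  · intro h
    exact Ideal.mem_homogeneousCore_of_homogeneous_of_mem ⟨d, hf⟩ ((Submodule.mem_iInf _).mpr h)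

/-- The terms in `I` vanish on every subscheme of `X`. -/
theorem monomial_mem_subschemeIdeal {φ : K →+* L}
    (h : b ≫ Spec.map (CommRingCat.ofHom φ) = a ≫ projStr (SGrading I)) {α : Term n}
    (hα : monomial α (1 : K) ∈ I.toIdeal) :
    monomial α (1 : L) ∈ (subschemeIdeal I a b).toIdeal := by
  refine (mem_subschemeIdeal_iff (isHomogeneous_monomial 1 rfl)).mpr fun j => ?_
  have hmap : monomial α (1 : L) = map φ (monomial α 1) := by
    rw [map_monomial, φ.map_one]
  rw [hmap, dehomogenize_map h j (isHomogeneous_monomial 1 rfl)]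
  have h0 : awayForm I j (isHomogeneous_monomial (1 : K) (rfl : α.degree = α.degree)) = 0 := by
    rw [awayForm, awayMk_eq_zero_iff]
    exact ⟨0, by rw [Ideal.Quotient.eq_zero_iff_mem.mpr hα, mul_zero]⟩
  rw [h0, map_zero, map_zero]

/-- The ideal of `Proj (S/U)` is the saturation of (the preimage of) `U`. -/
theorem mem_subschemeIdeal_projQuotι_iff (U : HomogeneousIdeal (SGrading I))
    {f : MvPolynomial (Fin (n + 1)) K} {d : ℕ} (hf : f.IsHomogeneous d) :
    f ∈ (subschemeIdeal I (projQuotι (SGrading I) U) (projStr _)).toIdeal ↔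
      ∀ j, ∃ N : ℕ, X j ^ N * f ∈ (U.comap (quotMk _ I)).toIdeal := by
  rw [mem_subschemeIdeal_iff hf]
  refine forall_congr' fun j => ?_
  have h : projStr (quotGrading (SGrading I) U) ≫ Spec.map (CommRingCat.ofHom (RingHom.id K)) =
      projQuotι (SGrading I) U ≫ projStr (SGrading I) := by
    rw [projQuotι_projStr, CommRingCat.ofHom_id]
    simp
  have h1 := (congrArg _ (MvPolynomial.map_id f).symm).trans (dehomogenize_map h j hf)
  refine (Eq.congr_left h1).trans ?_
  refine (projQuotι_app_eq_zero_iff (SGrading I) U (coord_mem I j) one_pos d _).trans ?_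
  refine exists_congr fun N => ?_
  change _ ↔ Ideal.Quotient.mk I.toIdeal (X j ^ N * f) ∈ U.toIdeal
  rw [map_mul, map_pow]
  rfl

end Dehomogenize

/-! ### Comparison of Hilbert functions -/

section Comparison

variable {n : ℕ} {K : Type u} [Field K]

theorem quotHilbertFunction_add_idealHilbertFunction_eq_ncard
    (J : HomogeneousIdeal (stdGrading n K)) (d : ℕ) :
    quotHilbertFunction _ J d + idealHilbertFunction _ J d =
      {α : Term n | α.degree = d}.ncard := by
  rw [quotHilbertFunction_add_idealHilbertFunction, finrank_stdGrading]

theorem quotHilbertFunction_eq_iff {L : Type u} [Field L] (J : HomogeneousIdeal (stdGrading n K))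
    (J' : HomogeneousIdeal (stdGrading n L)) (d : ℕ) :
    quotHilbertFunction _ J d = quotHilbertFunction _ J' d ↔
      idealHilbertFunction _ J d = idealHilbertFunction _ J' d := by
  have h := quotHilbertFunction_add_idealHilbertFunction_eq_ncard J d
  have h' := quotHilbertFunction_add_idealHilbertFunction_eq_ncard J' d
  omega

/-- An isomorphism of coefficient fields preserves supports, hence leading exponents. It serves to
replace `κ(y)` by `K` at a rational point. -/
theorem quotHilbertFunction_eq_of_map {L : Type u} [Field L] {φ : K →+* L}
    (hφ : Function.Bijective φ) (J : HomogeneousIdeal (stdGrading n K))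
    (J' : HomogeneousIdeal (stdGrading n L))
    (h : ∀ (f : MvPolynomial (Fin (n + 1)) K) (d : ℕ), f.IsHomogeneous d →
      (map φ f ∈ J'.toIdeal ↔ f ∈ J.toIdeal)) (d : ℕ) :
    quotHilbertFunction _ J' d = quotHilbertFunction _ J d := by
  have hdeg : ∀ f : MvPolynomial (Fin (n + 1)) K,
      MonomialOrder.lex.degree (map φ f) = MonomialOrder.lex.degree f := fun f => by
    rw [MonomialOrder.degree, MonomialOrder.degree, support_map_of_injective _ hφ.1]
  have hin : initialTerms J' = initialTerms J := by
    ext α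
    constructor
    · rintro ⟨f, hf, hd, h0, hα⟩
      obtain ⟨f, rfl⟩ := map_surjective φ hφ.2 f
      have hd' := hd.of_map hφ.1
      exact ⟨f, (h f _ hd').mp hf, hd', fun h => h0 (by rw [h, map_zero]), by rw [← hdeg, hα]⟩
    · rintro ⟨f, hf, hd, h0, hα⟩
      exact ⟨map φ f, (h f _ hd).mpr hf, hd.map φ,
        (map_ne_zero_iff _ (map_injective φ hφ.1)).mpr h0, by rw [hdeg, hα]⟩
  rw [quotHilbertFunction_eq_iff, idealHilbertFunction_eq_ncard, idealHilbertFunction_eq_ncard, hin]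

theorem quotHilbertFunction_anti {J J' : HomogeneousIdeal (stdGrading n K)}
    (d : ℕ) (h : ∀ f ∈ J.toIdeal, f.IsHomogeneous d → f ∈ J'.toIdeal) :
    quotHilbertFunction _ J' d ≤ quotHilbertFunction _ J d := by
  have h1 := quotHilbertFunction_add_idealHilbertFunction_eq_ncard J d
  have h2 := quotHilbertFunction_add_idealHilbertFunction_eq_ncard J' d
  have h3 : idealHilbertFunction _ J d ≤ idealHilbertFunction _ J' d := by
    have : FiniteDimensional K ↥(J'.toIdeal.restrictScalars K ⊓ stdGrading n K d) :=
      Submodule.finiteDimensional_of_le inf_le_right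
    exact Submodule.finrank_mono fun f hf => ⟨h f hf.1 hf.2, hf.2⟩
  omega

variable {I : HomogeneousIdeal (stdGrading n K)}

/-- An ideal is contained in its saturation (exponent `0`). Minimality of the lex point rests on
this inequality. -/
theorem subschemeHilbertFunction_projQuotι_le (U : HomogeneousIdeal (SGrading I)) (d : ℕ) :
    subschemeHilbertFunction I (projQuotι (SGrading I) U) (projStr _) d ≤
      quotHilbertFunction _ (U.comap (quotMk _ I)) d :=
  quotHilbertFunction_anti d fun _ hf hd =>
    (mem_subschemeIdeal_projQuotι_iff U hd).mpr fun _ => ⟨0, Ideal.mul_mem_left _ _ hf⟩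

theorem exists_subschemeHilbertFunction_projQuotι_eq (U : HomogeneousIdeal (SGrading I)) :
    ∃ D, ∀ d ≥ D, subschemeHilbertFunction I (projQuotι (SGrading I) U) (projStr _) d =
      quotHilbertFunction _ (U.comap (quotMk _ I)) d := by
  -- The criterion is known for forms; for general `f` the sum of the exponents of its finitely many
  -- components works for all of them.
  have hsat : ∀ f ∈ (subschemeIdeal I (projQuotι (SGrading I) U) (projStr _)).toIdeal, ∀ j,
      ∃ N, X j ^ N * f ∈ (U.comap (quotMk _ I)).toIdeal := by
    intro f hf j
    have hcomp : ∀ d, ∃ N, X j ^ N * (DirectSum.decompose (stdGrading n K) f d :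
        MvPolynomial (Fin (n + 1)) K) ∈ (U.comap (quotMk _ I)).toIdeal := fun d =>
      (mem_subschemeIdeal_projQuotι_iff U (DirectSum.decompose (stdGrading n K) f d).2).mp
        ((HomogeneousIdeal.isHomogeneous _) d hf) j
    choose N hN using hcomp
    classical
    refine ⟨∑ d ∈ (DirectSum.decompose (stdGrading n K) f).support, N d, ?_⟩
    conv => arg 2; arg 2; rw [← DirectSum.sum_support_decompose (stdGrading n K) f]
    rw [Finset.mul_sum]
    refine Ideal.sum_mem _ fun d hd => ?_
    obtain ⟨k, hk⟩ := Nat.exists_eq_add_of_le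
      (Finset.single_le_sum (f := N) (fun _ _ => Nat.zero_le _) hd)
    rw [hk, pow_add, mul_comm (X j ^ N d), mul_assoc]
    exact Ideal.mul_mem_left _ _ (hN d)
  obtain ⟨D, hD⟩ := exists_forall_isHomogeneous_mem hsat
  exact ⟨D, fun d hd => le_antisymm (subschemeHilbertFunction_projQuotι_le U d)
    (quotHilbertFunction_anti d (hD d hd))⟩

theorem IsLexIdeal.inf_eq_inf_of_quotHilbertFunction_eq {U V : HomogeneousIdeal (SGrading I)}
    (hU : IsLexIdeal I U) (hV : IsLexIdeal I V) {d : ℕ}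
    (h : quotHilbertFunction _ (U.comap (quotMk _ I)) d =
      quotHilbertFunction _ (V.comap (quotMk _ I)) d) :
    U.toIdeal.restrictScalars K ⊓ SGrading I d = V.toIdeal.restrictScalars K ⊓ SGrading I d := by
  refine hU.inf_eq_inf hV ?_
  rw [quotHilbertFunction_eq_iff, idealHilbertFunction_comap, idealHilbertFunction_comap] at h
  exact Nat.add_right_cancel h

/-- Lex-ideals with the same Hilbert function in large degrees define the same subscheme. -/
theorem IsLexIdeal.exists_isIso {U V : HomogeneousIdeal (SGrading I)}
    (hU : IsLexIdeal I U) (hV : IsLexIdeal I V) {D : ℕ}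
    (h : ∀ d ≥ D, quotHilbertFunction _ (U.comap (quotMk _ I)) d =
      quotHilbertFunction _ (V.comap (quotMk _ I)) d) :
    ∃ g : Proj (quotGrading (SGrading I) U) ⟶ Proj (quotGrading (SGrading I) V), IsIso g ∧
      g ≫ projQuotι (SGrading I) V = projQuotι (SGrading I) U := by
  have heq := fun d hd => hU.inf_eq_inf_of_quotHilbertFunction_eq hV (h d hd)
  have hker : (projQuotι (SGrading I) V).ker = (projQuotι (SGrading I) U).ker :=
    le_antisymm
      (ker_projQuotι_le (D := D) fun d hd _ hx hxV => ((heq d hd).ge ⟨hxV, hx⟩).1)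
      (ker_projQuotι_le (D := D) fun d hd _ hx hxU => ((heq d hd).le ⟨hxU, hx⟩).1)
  exact ⟨IsClosedImmersion.lift _ _ hker.le, IsClosedImmersion.isIso_lift _ _ hker,
    IsClosedImmersion.lift_fac _ _ _⟩

end Comparison

/-! ### Invariance of Hilbert functions under isomorphisms -/

section Invariance

variable {n : ℕ} {K : Type u} [Field K] {I : HomogeneousIdeal (stdGrading n K)}
  {Z₁ Z₂ : Scheme.{u}} {L₁ L₂ : Type u} [Field L₁] [Field L₂]

theorem dehomogenize_C (a : Z₁ ⟶ ProjS I) (b : Z₁ ⟶ Spec (.of L₁)) (j : Fin (n + 1)) (c : L₁) :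
    dehomogenize I a b j (C c) = ((Scheme.ΓSpecIso (.of L₁)).inv ≫ b.appTop ≫
      Z₁.presheaf.map (homOfLE (le_top :
        a ⁻¹ᵁ Proj.basicOpen (SGrading I) (coord I j) ≤ ⊤)).op).hom c :=
  eval₂Hom_C _ _ _

theorem dehomogenize_X (a : Z₁ ⟶ ProjS I) (b : Z₁ ⟶ Spec (.of L₁)) (j i : Fin (n + 1)) :
    dehomogenize I a b j (X i) =
      (a.app (Proj.basicOpen (SGrading I) (coord I j))).hom (coordRatio I j i) :=
  eval₂Hom_X' _ _ _

theorem dehomogenize_comp (e : Z₁ ⟶ Z₂) (a : Z₂ ⟶ ProjS I) (b₁ : Z₁ ⟶ Spec (.of L₁))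
    (b₂ : Z₂ ⟶ Spec (.of L₂)) (φ : L₂ →+* L₁) (hb : e ≫ b₂ = b₁ ≫ Spec.map (CommRingCat.ofHom φ))
    (j : Fin (n + 1)) (f : MvPolynomial (Fin (n + 1)) L₂) :
    dehomogenize I (e ≫ a) b₁ j (map φ f) =
      (e.app (a ⁻¹ᵁ Proj.basicOpen (SGrading I) (coord I j))).hom (dehomogenize I a b₂ j f) := by
  suffices H : (dehomogenize I (e ≫ a) b₁ j).comp (map φ) =
      (e.app (a ⁻¹ᵁ Proj.basicOpen (SGrading I) (coord I j))).hom.comp (dehomogenize I a b₂ j) from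
    congrArg (fun g => g f) H
  refine MvPolynomial.ringHom_ext (fun c => ?_) fun i => ?_
  · have h1 : CommRingCat.ofHom φ ≫ (Scheme.ΓSpecIso (.of L₁)).inv ≫ b₁.appTop ≫
        Z₁.presheaf.map (homOfLE (le_top :
          (e ≫ a) ⁻¹ᵁ Proj.basicOpen (SGrading I) (coord I j) ≤ ⊤)).op =
        (Scheme.ΓSpecIso (.of L₂)).inv ≫ b₂.appTop ≫ Z₂.presheaf.map (homOfLE (le_top :
          a ⁻¹ᵁ Proj.basicOpen (SGrading I) (coord I j) ≤ ⊤)).op ≫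
        e.app (a ⁻¹ᵁ Proj.basicOpen (SGrading I) (coord I j)) := by
      rw [Scheme.ΓSpecIso_inv_naturality_assoc, ← Scheme.Hom.comp_appTop_assoc, ← hb,
        Scheme.Hom.comp_appTop_assoc, Scheme.Hom.naturality]
      rfl
    have h2 := congrArg (fun g => g.hom c) h1
    change dehomogenize I (e ≫ a) b₁ j (map φ (C c)) = (e.app _).hom (dehomogenize I a b₂ j (C c))
    rw [map_C, dehomogenize_C, dehomogenize_C]
    exact h2
  · change dehomogenize I (e ≫ a) b₁ j (map φ (X i)) = (e.app _).hom (dehomogenize I a b₂ j (X i))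
    rw [map_X, dehomogenize_X, dehomogenize_X]
    rfl

/-- Pulling functions back along `e` is injective, so the same forms vanish. Two fields are allowed
because a fibre lives over `κ(y)` and the pulled back subscheme over `K`. -/
theorem subschemeHilbertFunction_eq_of_isIso (e : Z₁ ⟶ Z₂) [IsIso e] {a₁ : Z₁ ⟶ ProjS I}
    {a₂ : Z₂ ⟶ ProjS I} (ha : e ≫ a₂ = a₁) {b₁ : Z₁ ⟶ Spec (.of L₁)} {b₂ : Z₂ ⟶ Spec (.of L₂)}
    {φ : L₂ →+* L₁} (hφ : Function.Bijective φ)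
    (hb : e ≫ b₂ = b₁ ≫ Spec.map (CommRingCat.ofHom φ)) (d : ℕ) :
    subschemeHilbertFunction I a₁ b₁ d = subschemeHilbertFunction I a₂ b₂ d := by
  subst ha
  refine quotHilbertFunction_eq_of_map hφ _ _ (fun f d hf => ?_) d
  rw [mem_subschemeIdeal_iff hf, mem_subschemeIdeal_iff (hf.map φ)]
  refine forall_congr' fun j => ?_
  rw [dehomogenize_comp e a₂ b₁ b₂ φ hb]
  exact map_eq_zero_iff _ (ConcreteCategory.bijective_of_isIso (e.app _)).1

/-- The Hilbert function of the fibre over a `K`-rational point is that of the pulled back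
subscheme. -/
theorem fiberHilbertFunction_eq_of_isPullback {H Z W : Scheme.{u}} {η : H ⟶ Spec (.of K)}
    {toX : Z ⟶ ProjS I} {toH : Z ⟶ H} {s : Spec (.of K) ⟶ H} (hs : s ≫ η = 𝟙 _)
    {g : W ⟶ Z} {toK : W ⟶ Spec (.of K)} (hg : IsPullback g toK toH s)
    {y : H} (hy : s (IsLocalRing.closedPoint K) = y) (d : ℕ) :
    fiberHilbertFunction I toX toH y d = subschemeHilbertFunction I (g ≫ toX) toK d := by
  subst hy
  set y := s (IsLocalRing.closedPoint K)
  let σ : H.residueField y ⟶ .of K := H.descResidueField (Scheme.stalkClosedPointTo s)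
  have hσ : Spec.map σ ≫ H.fromSpecResidueField y = s :=
    Scheme.descResidueField_stalkClosedPointTo_fromSpecResidueField K H s
  -- Since `s` is a section of `η`, the composite `K → κ(y) → K` is the identity, which gives
  -- surjectivity.
  have hbij : Function.Bijective σ.hom := by
    refine ⟨σ.hom.injective, fun c => ?_⟩
    obtain ⟨τ, hτ⟩ := Spec.map_surjective (H.fromSpecResidueField y ≫ η)
    have h1 : τ ≫ σ = 𝟙 _ := by
      apply Spec.map_injective
      rw [Spec.map_comp, hτ, ← Category.assoc, hσ, hs, Spec.map_id]
    exact ⟨τ.hom c, congrArg (fun f => f.hom c) h1⟩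
  have : IsIso σ := (ConcreteCategory.isIso_iff_bijective σ).mpr hbij
  have hfib : IsPullback (toH.fiberι y) (toH.fiberToSpecResidueField y) toH
      (H.fromSpecResidueField y) := IsPullback.of_hasPullback _ _
  have hw : g ≫ toH = (toK ≫ Spec.map σ) ≫ H.fromSpecResidueField y := by
    rw [Category.assoc, hσ, hg.w]
  -- By pasting, `W` is the base change of the fibre along the isomorphism `Spec.map σ`, so `W` is
  -- isomorphic to the fibre.
  have hleft : IsPullback (hfib.lift g (toK ≫ Spec.map σ) hw) toK
      (toH.fiberToSpecResidueField y) (Spec.map σ) := by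
    refine IsPullback.of_right ?_ (hfib.lift_snd _ _ _) hfib
    rw [hfib.lift_fst, hσ]
    exact hg
  have : IsIso (hfib.lift g (toK ≫ Spec.map σ) hw) := hleft.isIso_fst_of_isIso
  refine (subschemeHilbertFunction_eq_of_isIso (hfib.lift g (toK ≫ Spec.map σ) hw) ?_ hbij
    (hfib.lift_snd _ _ _) d).symm
  rw [← Category.assoc, hfib.lift_fst]

/-- The residue field of the point of `Spec K` is only isomorphic to `K`; the preceding comparison
with `s = 𝟙` removes the difference. -/
theorem fiberHilbertFunction_eq_of_isIso {Z : Scheme.{u}} {toX : Z ⟶ ProjS I}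
    {toK : Z ⟶ Spec (.of K)} (x : Spec (.of K)) (d : ℕ) :
    fiberHilbertFunction I toX toK x d = subschemeHilbertFunction I toX toK d := by
  have h := fiberHilbertFunction_eq_of_isPullback (I := I) (toX := toX) (η := 𝟙 _)
    (Category.comp_id (𝟙 (Spec (.of K)))) (IsPullback.id_horiz toK) (y := x)
    (Subsingleton.elim _ _) d
  rwa [Category.id_comp] at h

end Invariance

/-! ### The Hilbert functor -/

section HilbertFunctor

variable {n : ℕ} {K : Type u} [Field K] {I : HomogeneousIdeal (stdGrading n K)}

namespace Family

variable {p : Polynomial ℚ}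

/-- Every member of a family has the Hilbert function of `S/V` for some lex-ideal `V`. -/
theorem exists_isLexIdeal (hqs : IsQuasiStable I.toIdeal) (hML : IsMacaulayLex I) {T : Scheme.{u}}
    {π : T ⟶ Spec (.of K)} (F : Family I p π) (t : T) :
    ∃ V : HomogeneousIdeal (SGrading I), IsLexIdeal I V ∧ ∀ d,
      quotHilbertFunction _ (V.comap (quotMk _ I)) d = F.hilbertFunctionAt t d := by
  obtain ⟨φ, hφ⟩ := Spec.map_surjective (T.fromSpecResidueField t ≫ π)
  have h : F.toT.fiberToSpecResidueField t ≫ Spec.map φ =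
      (F.toT.fiberι t ≫ F.toX) ≫ projStr (SGrading I) := by
    rw [hφ, Category.assoc, F.comm, Scheme.Hom.fiber_fac_assoc]
  obtain ⟨V, hV, hVd⟩ := LexPoint.exists_isLexIdeal hqs hML _
    fun α hα => monomial_mem_subschemeIdeal (φ := φ.hom) h hα
  exact ⟨V, hV, fun d => (quotHilbertFunction_eq_iff _ _ d).mpr (hVd d)⟩

/-- The family `Proj (S/U)` over `Spec K`. -/
noncomputable def ofIdeal (U : HomogeneousIdeal (SGrading I))
    (hU : ∃ N : ℕ, ∀ d ≥ N, (quotHilbertFunction _ (U.comap (quotMk _ I)) d : ℚ) = p.eval (d : ℚ)) :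
    Family I p (𝟙 (Spec (.of K))) where
  Z := Proj (quotGrading (SGrading I) U)
  toX := projQuotι (SGrading I) U
  toT := projStr (quotGrading (SGrading I) U)
  comm := by rw [projQuotι_projStr, Category.comp_id]
  isClosedImmersion := by
    -- Under `X ×_K Spec K ≅ X` the lift becomes `projQuotι`, a closed immersion.
    have : IsIso (pullback.fst (projStr (SGrading I)) (𝟙 (Spec (.of K)))) := inferInstance
    have h : pullback.lift (projQuotι (SGrading I) U) (projStr (quotGrading (SGrading I) U))
        (by rw [projQuotι_projStr, Category.comp_id]) ≫
        pullback.fst (projStr (SGrading I)) (𝟙 (Spec (.of K))) = projQuotι (SGrading I) U :=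
      pullback.lift_fst _ _ _
    have : IsClosedImmersion (pullback.lift (projQuotι (SGrading I) U)
        (projStr (quotGrading (SGrading I) U)) (by rw [projQuotι_projStr, Category.comp_id]) ≫
        pullback.fst (projStr (SGrading I)) (𝟙 (Spec (.of K)))) := by
      rw [h]; infer_instance
    exact IsClosedImmersion.of_comp_isClosedImmersion _
      (pullback.fst (projStr (SGrading I)) (𝟙 (Spec (.of K))))
  flat := inferInstance
  locallyOfFinitePresentation := by
    have : FiniteDimensional K (quotGrading (SGrading I) U 0) :=
      Module.Finite.map (SGrading I 0) _
    have : Algebra.FiniteType K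
        ((MvPolynomial (Fin (n + 1)) K ⧸ I.toIdeal) ⧸ U.toIdeal) :=
      Algebra.FiniteType.of_surjective (Ideal.Quotient.mkₐ K U.toIdeal)
        (Ideal.Quotient.mkₐ_surjective K U.toIdeal)
    -- Over the Noetherian base `Spec K`, finite type and finite presentation agree.
    exact LocallyOfFinitePresentation.iff_locallyOfFiniteType.mpr
      (locallyOfFiniteType_projStr (quotGrading (SGrading I) U))
  hilbertPolynomial := by
    intro t
    obtain ⟨N, hN⟩ := hU
    obtain ⟨D, hD⟩ := exists_subschemeHilbertFunction_projQuotι_eq U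
    refine ⟨max N D, fun d hd => ?_⟩
    rw [fiberHilbertFunction_eq_of_isIso, hD d (le_of_max_le_right hd),
      hN d (le_of_max_le_left hd)]

theorem isDefinedByLexIdeal_ofIdeal {U : HomogeneousIdeal (SGrading I)} (hU : IsLexIdeal I U)
    (h : ∃ N : ℕ, ∀ d ≥ N, (quotHilbertFunction _ (U.comap (quotMk _ I)) d : ℚ) = p.eval (d : ℚ)) :
    (ofIdeal U h).IsDefinedByLexIdeal :=
  ⟨U, hU, Iso.refl _, Category.id_comp _⟩

theorem toT_eq (F : Family I p (𝟙 (Spec (.of K)))) : F.toT = F.toX ≫ projStr (SGrading I) := by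
  rw [F.comm, Category.comp_id]

theorem hilbertFunctionAt_eq_of_isIso (F : Family I p (𝟙 (Spec (.of K))))
    {U : HomogeneousIdeal (SGrading I)} (e : F.Z ⟶ Proj (quotGrading (SGrading I) U)) [IsIso e]
    (he : e ≫ projQuotι (SGrading I) U = F.toX) (x : Spec (.of K)) (d : ℕ) :
    F.hilbertFunctionAt x d =
      subschemeHilbertFunction I (projQuotι (SGrading I) U) (projStr _) d := by
  rw [hilbertFunctionAt, fiberHilbertFunction_eq_of_isIso]
  refine subschemeHilbertFunction_eq_of_isIso e he (φ := RingHom.id K) Function.bijective_id ?_ d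
  rw [← projQuotι_projStr, ← Category.assoc, he, toT_eq, CommRingCat.ofHom_id]
  simp

/-- The Hilbert polynomial of a family defined by a lex-ideal. -/
theorem quotHilbertFunction_eq_eval (F : Family I p (𝟙 (Spec (.of K))))
    {U : HomogeneousIdeal (SGrading I)} (e : F.Z ⟶ Proj (quotGrading (SGrading I) U)) [IsIso e]
    (he : e ≫ projQuotι (SGrading I) U = F.toX) :
    ∃ N : ℕ, ∀ d ≥ N, (quotHilbertFunction _ (U.comap (quotMk _ I)) d : ℚ) = p.eval (d : ℚ) := by
  let x : Spec (.of K) := IsLocalRing.closedPoint K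
  obtain ⟨N, hN⟩ := F.hilbertPolynomial x
  obtain ⟨D, hD⟩ := exists_subschemeHilbertFunction_projQuotι_eq U
  refine ⟨max N D, fun d hd => ?_⟩
  rw [← hD d (le_of_max_le_right hd), ← hilbertFunctionAt_eq_of_isIso F e he x,
    ← hN d (le_of_max_le_left hd)]
  rfl

theorem exists_isDefinedByLexIdeal (hqs : IsQuasiStable I.toIdeal) (hML : IsMacaulayLex I)
    {T : Scheme.{u}} {π : T ⟶ Spec (.of K)} (F : Family I p π) (t : T) :
    ∃ Y : Family I p (𝟙 (Spec (.of K))), Y.IsDefinedByLexIdeal := by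
  obtain ⟨V, hV, hVd⟩ := F.exists_isLexIdeal hqs hML t
  obtain ⟨N, hN⟩ := F.hilbertPolynomial t
  exact ⟨ofIdeal V ⟨N, fun d hd => by rw [hVd d]; exact hN d hd⟩, isDefinedByLexIdeal_ofIdeal hV _⟩

theorem exists_forall_ge_eq {f g : ℕ → ℕ}
    (hf : ∃ N : ℕ, ∀ d ≥ N, (f d : ℚ) = p.eval (d : ℚ))
    (hg : ∃ N : ℕ, ∀ d ≥ N, (g d : ℚ) = p.eval (d : ℚ)) : ∃ D, ∀ d ≥ D, f d = g d := by
  obtain ⟨N, hN⟩ := hf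
  obtain ⟨D, hD⟩ := hg
  refine ⟨max N D, fun d hd => ?_⟩
  exact_mod_cast (hN d (le_of_max_le_left hd)).trans (hD d (le_of_max_le_right hd)).symm

/-- Both lex-ideals have Hilbert polynomial `p`, so they agree in large degrees and define the same
closed subscheme. -/
theorem IsDefinedByLexIdeal.isPullbackOf {Y Y' : Family I p (𝟙 (Spec (.of K)))}
    (hY : Y.IsDefinedByLexIdeal) (hY' : Y'.IsDefinedByLexIdeal) : Y.IsPullbackOf Y' (𝟙 _) := by
  obtain ⟨U, hU, e, he⟩ := hY
  obtain ⟨U', hU', e', he'⟩ := hY'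
  obtain ⟨D, hD⟩ := exists_forall_ge_eq (Y.quotHilbertFunction_eq_eval e.hom he)
    (Y'.quotHilbertFunction_eq_eval e'.hom he')
  obtain ⟨g, hg, hgι⟩ := hU.exists_isIso hU' hD
  have hw : (e.hom ≫ g ≫ e'.inv) ≫ Y'.toX = Y.toX := by
    rw [← he', Category.assoc, Category.assoc, e'.inv_hom_id_assoc, hgι, he]
  refine ⟨e.hom ≫ g ≫ e'.inv, hw, IsPullback.of_horiz_isIso ⟨?_⟩⟩
  rw [Y'.toT_eq, ← Category.assoc, hw, Y.toT_eq, Category.comp_id]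

/-- The lex-ideal `V` attached to the fibre matches it in every degree and agrees with `U` in large
degrees, so `Y` is also `Proj (S/V)`; saturating `V` can only lower the Hilbert function. -/
theorem IsDefinedByLexIdeal.hilbertFunctionAt_le (hqs : IsQuasiStable I.toIdeal)
    (hML : IsMacaulayLex I) {Y : Family I p (𝟙 (Spec (.of K)))} (hY : Y.IsDefinedByLexIdeal)
    {T : Scheme.{u}} {π : T ⟶ Spec (.of K)} (F : Family I p π) (t : T) (x : Spec (.of K)) (d : ℕ) :
    Y.hilbertFunctionAt x d ≤ F.hilbertFunctionAt t d := by
  obtain ⟨U, hU, e, he⟩ := hY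
  obtain ⟨V, hV, hVd⟩ := F.exists_isLexIdeal hqs hML t
  obtain ⟨N, hN⟩ := F.hilbertPolynomial t
  obtain ⟨D, hD⟩ := exists_forall_ge_eq (Y.quotHilbertFunction_eq_eval e.hom he)
    (g := quotHilbertFunction _ (V.comap (quotMk _ I)))
    ⟨N, fun d hd => by rw [hVd d]; exact hN d hd⟩
  obtain ⟨g, hg, hgι⟩ := hU.exists_isIso hV hD
  rw [Y.hilbertFunctionAt_eq_of_isIso (e.hom ≫ g) (by rw [Category.assoc, hgι, he]), ← hVd d]
  exact subschemeHilbertFunction_projQuotι_le V d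

variable {H : Scheme.{u}} {η : H ⟶ Spec (.of K)} {G : Family I p η}

theorem IsPullbackOf.trans {F F' : Family I p (𝟙 (Spec (.of K)))} {s : Spec (.of K) ⟶ H}
    (h : F.IsPullbackOf F' (𝟙 _)) (h' : F'.IsPullbackOf G s) : F.IsPullbackOf G s := by
  obtain ⟨g, hg, hpb⟩ := h
  obtain ⟨g', hg', hpb'⟩ := h'
  refine ⟨g ≫ g', by rw [Category.assoc, hg', hg], ?_⟩
  have := hpb.paste_horiz hpb'
  rwa [Category.id_comp] at this

theorem IsPullbackOf.hilbertFunctionAt_eq {F : Family I p (𝟙 (Spec (.of K)))}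
    {s : Spec (.of K) ⟶ H} (hs : s ≫ η = 𝟙 _) (h : F.IsPullbackOf G s) (x : Spec (.of K)) (d : ℕ) :
    G.hilbertFunctionAt (s x) d = F.hilbertFunctionAt x d := by
  obtain ⟨g, hg, hpb⟩ := h
  rw [hilbertFunctionAt, hilbertFunctionAt, fiberHilbertFunction_eq_of_isIso, ← hg]
  exact fiberHilbertFunction_eq_of_isPullback hs hpb
    (congrArg (fun z => s z) (Subsingleton.elim _ _)) d

end Family

end HilbertFunctor

end LexPoint

/-- `I` is a saturated quasi-stable ideal such that `S = R/I` is Macaulay–Lex, and `X = Proj S`.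
The first part is about the Hilbert functor of `X` and `p`, the second about the Hilbert scheme `H`,
which represents it, with its universal family `G`. -/
theorem mainTheorem2 {K : Type u} [Field K] {n : ℕ}
    (I : HomogeneousIdeal (LexPoint.stdGrading n K))
    (hqs : LexPoint.IsQuasiStable I.toIdeal) (hsat : LexPoint.IsSaturated I.toIdeal)
    (hML : LexPoint.IsMacaulayLex I) (p : Polynomial ℚ) :
    (((∃ (T : Scheme.{u}) (π : T ⟶ Spec (.of K)), Nonempty T ∧ Nonempty (LexPoint.Family I p π)) ↔
        ∃ Y : LexPoint.Family I p (𝟙 (Spec (.of K))), Y.IsDefinedByLexIdeal) ∧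
      (∀ Y Y' : LexPoint.Family I p (𝟙 (Spec (.of K))),
        Y.IsDefinedByLexIdeal → Y'.IsDefinedByLexIdeal → Y.IsPullbackOf Y' (𝟙 _)) ∧
      (∀ Y : LexPoint.Family I p (𝟙 (Spec (.of K))), Y.IsDefinedByLexIdeal →
        ∀ (T : Scheme.{u}) (π : T ⟶ Spec (.of K)) (F : LexPoint.Family I p π) (t : T)
          (x : Spec (.of K)) (d : ℕ), Y.hilbertFunctionAt x d ≤ F.hilbertFunctionAt t d)) ∧
    ∀ (H : Scheme.{u}) (η : H ⟶ Spec (.of K)) (G : LexPoint.Family I p η), G.IsUniversal →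
      (Nonempty H ↔ ∃! y : H, G.IsLexPoint y) ∧
      (∀ y : H, G.IsLexPoint y →
        ∀ (z : H) (d : ℕ), G.hilbertFunctionAt y d ≤ G.hilbertFunctionAt z d) := by

  have hle := fun (Y : LexPoint.Family I p (𝟙 (Spec (.of K)))) (hY : Y.IsDefinedByLexIdeal)
    (T : Scheme.{u}) (π : T ⟶ Spec (.of K)) (F : LexPoint.Family I p π) (t : T) =>
    hY.hilbertFunctionAt_le hqs hML F t
  refine ⟨⟨⟨?_, ?_⟩, fun Y Y' hY hY' => hY.isPullbackOf hY', hle⟩, fun H η G hG => ⟨⟨?_, ?_⟩, ?_⟩⟩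
  · rintro ⟨T, π, ⟨t⟩, ⟨F⟩⟩
    exact F.exists_isDefinedByLexIdeal hqs hML t
  · rintro ⟨Y, -⟩
    exact ⟨Spec (.of K), 𝟙 _, ⟨IsLocalRing.closedPoint K⟩, ⟨Y⟩⟩
  · rintro ⟨y⟩
    obtain ⟨Y, hY⟩ := G.exists_isDefinedByLexIdeal hqs hML y
    -- Universality turns the subscheme `Y` of `X` into a rational point of `H`.
    obtain ⟨s, ⟨hs, hsY⟩, -⟩ := hG _ Y
    refine ⟨s (IsLocalRing.closedPoint K), ⟨s, hs, fun x => congrArg (fun z => s z)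
      (Subsingleton.elim _ _), Y, hY, hsY⟩, ?_⟩
    rintro y' ⟨s', hs', hy', Y', hY', hsY'⟩
    -- As `Y` and `Y'` are the same subscheme, both `s` and `s'` classify `Y`.
    obtain rfl : s = s' := (hG _ Y).unique ⟨hs, hsY⟩ ⟨hs', (hY.isPullbackOf hY').trans hsY'⟩
    exact (hy' _).symm
  · rintro ⟨y, -⟩
    exact ⟨y⟩
  · rintro y ⟨s, hs, hy, Y, hY, hsY⟩ z d
    let x : Spec (.of K) := IsLocalRing.closedPoint K
    rw [← hy x, hsY.hilbertFunctionAt_eq hs]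
    exact hle Y hY H η G z x d
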